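/- **Language.** Fix a finite set $\mathsf{VID}$ of real-valued program variables, a finite set $\mathsf{FID}$ of function identifiers, and a collection of primitive distribution expressions $D$, each denoting a Borel probability measure $\mu_D$ on $\mathbb R$; it contains all $\mathsf{uniform}(a,b)$ with $a<b$ (density $\frac{1}{b-a}\mathbf 1_{[a,b]}$), and possibly further ones, forming a separable extended metric space on which $D\mapsto\mu_D$ is a probability kernel. Expressions are $E ::= x\mid c\mid E_1+E_2\mid E_1\cdot E_2$ ($c\in\mathbb R$), conditions are $L ::= \mathsf{tt}\mid \neg L\mid L_1\wedge L_2\mid E_1\le E_2$, and statements are $$S ::= \mathsf{skip}\mid \mathsf{tick}(c)\mid x:=E\mid x\sim D\mid \mathsf{call}\,f\mid \mathsf{while}\,L\,\mathsf{do}\,S\mid \mathsf{if\ prob}(p)\,\mathsf{then}\,S_1\,\mathsf{else}\,S_2\mid \mathsf{if}\,L\,\mathsf{then}\,S_1\,\mathsf{else}\,S_2\mid S_1;S_2,$$ with $p\in[0,1]$. Continuations are $K ::= \mathsf{Kstop}\mid \mathsf{Kloop}\,L\,S\,K\mid \mathsf{Kseq}\,S\,K$. A program is a map $\mathscr D$ from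 $\mathsf{FID}$ to statements together with a statement $S_{\mathsf{main}}$. **Semantics.** A configuration is $\langle\gamma,S,K,\alpha\rangle$ with a valuation $\gamma:\mathsf{VID}\to\mathbb R$ and accumulated cost $\alpha\in\mathbb R$. One step sends a configuration to a probability distribution on configurations ($\delta$ is the Dirac measure; $E(\gamma)$, $L(\gamma)$ are the values at $\gamma$): $\langle\gamma,\mathsf{skip},\mathsf{Kstop},\alpha\rangle\mapsto\delta\langle\gamma,\mathsf{skip},\mathsf{Kstop},\alpha\rangle$; $\langle\gamma,\mathsf{skip},\mathsf{Kloop}\,L\,S\,K,\alpha\rangle\mapsto\delta\langle\gamma,S,\mathsf{Kloop}\,L\,S\,K,\alpha\rangle$ if $L(\gamma)$ is true, and $\mapsto\delta\langle\gamma,\mathsf{skip},K,\alpha\rangle$ otherwise; $\langle\gamma,\mathsf{skip},\mathsf{Kseq}\,S\,K,\alpha\rangle\mapsto\delta\langle\gamma,S,K,\alpha\rangle$; $\langle\gamma,\mathsf{tick}(c),K,\alpha\rangle\mapsto\delta\langle\gamma,\mathsf{skip},K,\alpha+c\rangle$; $\langle\gamma,x:=E,K,\alpha\rangle\mapsto\delta\langle\gamma[x\mapsto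 E(\gamma)],\mathsf{skip},K,\alpha\rangle$; $\langle\gamma,x\sim D,K,\alpha\rangle\mapsto$ the law of $\langle\gamma[x\mapsto r],\mathsf{skip},K,\alpha\rangle$ for $r\sim\mu_D$; $\langle\gamma,\mathsf{call}\,f,K,\alpha\rangle\mapsto\delta\langle\gamma,\mathscr D(f),K,\alpha\rangle$; $\langle\gamma,\mathsf{if\ prob}(p)\,\mathsf{then}\,S_1\,\mathsf{else}\,S_2,K,\alpha\rangle\mapsto p\,\delta\langle\gamma,S_1,K,\alpha\rangle+(1-p)\,\delta\langle\gamma,S_2,K,\alpha\rangle$; $\langle\gamma,\mathsf{if}\,L\,\mathsf{then}\,S_1\,\mathsf{else}\,S_2,K,\alpha\rangle\mapsto\delta\langle\gamma,S_1,K,\alpha\rangle$ if $L(\gamma)$ is true, and $\mapsto\delta\langle\gamma,S_2,K,\alpha\rangle$ otherwise; $\langle\gamma,\mathsf{while}\,L\,\mathsf{do}\,S,K,\alpha\rangle\mapsto\delta\langle\gamma,\mathsf{skip},\mathsf{Kloop}\,L\,S\,K,\alpha\rangle$; $\langle\gamma,S_1;S_2,K,\alpha\rangle\mapsto\delta\langle\gamma,S_1,\mathsf{Kseq}\,S_2\,K,\alpha\rangle$.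 Valuations and costs carry their Borel $\sigma$-algebras. Statements and continuations carry the Borel $\sigma$-algebras of the extended metrics in which trees with the same skeleton are compared by the sum of the distances of their real (and distribution) parameters, and trees with different skeletons have distance $\infty$. Configurations carry the product $\sigma$-algebra, on which $\mapsto$ is a probability kernel. Let $\mathbb P$ be the law (Ionescu-Tulcea) on infinite traces $\omega=(\omega_n)_{n\ge 0}$ of the Markov chain with this kernel started at $\langle\lambda\_.0,S_{\mathsf{main}},\mathsf{Kstop},0\rangle$. Write $\omega_n=\langle\gamma_n,\_,\_,\alpha_n\rangle$, $A_n=\alpha_n$, let $T(\omega)=\inf\{n\ge0:\omega_n=\langle\_,\mathsf{skip},\mathsf{Kstop},\_\rangle\}\in\{0,1,\dots\}\cup\{\infty\}$, and $A_T(\omega)=A_{T(\omega)}(\omega)$ where $T(\omega)<\infty$. **Logic.** A logical context $\Gamma$ is a predicate on valuations and a potential annotation $Q$ is a real-valued function on valuations. A context $\Delta$ assigns to each $f\in\mathsf{FID}$ finitely many (possibly no) specifications $(\Gamma;Q,\Gamma';Q')$. Triples $\Delta\vdash\{\Gamma;Q\}\,S\,\{\Gamma';Q'\}$ are derived by the following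 rules: * $\{\Gamma;Q\}\,\mathsf{skip}\,\{\Gamma;Q\}$. * $\{\Gamma;Q'+c\}\,\mathsf{tick}(c)\,\{\Gamma;Q'\}$. * $\{[E/x]\Gamma';[E/x]Q'\}\;x:=E\;\{\Gamma';Q'\}$, where $([E/x]Q')(\gamma)=Q'(\gamma[x\mapsto E(\gamma)])$ and likewise for $\Gamma'$. * $\{\forall x\in\mathrm{supp}(\mu_D).\,\Gamma';\ \mathbb E_{x\sim\mu_D}[Q']\}\;x\sim D\;\{\Gamma';Q'\}$, provided these expectations exist, i.e. $r\mapsto Q'(\gamma[x\mapsto r])$ is $\mu_D$-integrable for every $\gamma$. * From $\{\Gamma\wedge L;Q\}\,S\,\{\Gamma;Q\}$ infer $\{\Gamma;Q\}\,\mathsf{while}\,L\,\mathsf{do}\,S\,\{\Gamma\wedge\neg L;Q\}$. * From $\{\Gamma\wedge L;Q\}\,S_1\,\{\Gamma';Q'\}$ and $\{\Gamma\wedge\neg L;Q\}\,S_2\,\{\Gamma';Q'\}$ infer $\{\Gamma;Q\}\,\mathsf{if}\,L\,\mathsf{then}\,S_1\,\mathsf{else}\,S_2\,\{\Gamma';Q'\}$.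 * From $\{\Gamma;Q\}\,S_1\,\{\Gamma';Q'\}$ and $\{\Gamma';Q'\}\,S_2\,\{\Gamma'';Q''\}$ infer $\{\Gamma;Q\}\,S_1;S_2\,\{\Gamma'';Q''\}$. * If $(\Gamma;Q,\Gamma';Q')\in\Delta(f)$ and $c\in\mathbb R$, then $\{\Gamma;Q+c\}\,\mathsf{call}\,f\,\{\Gamma';Q'+c\}$. * From $\{\Gamma;Q_i\}\,S_i\,\{\Gamma';Q'\}$ for $i=1,2$ infer $\{\Gamma;\,pQ_1+(1-p)Q_2\}\,\mathsf{if\ prob}(p)\,\mathsf{then}\,S_1\,\mathsf{else}\,S_2\,\{\Gamma';Q'\}$. * From $\{\Gamma_0;Q_0\}\,S\,\{\Gamma_0';Q_0'\}$ infer $\{\Gamma;Q\}\,S\,\{\Gamma';Q'\}$, provided $\Gamma\Rightarrow\Gamma_0$, $\Gamma_0'\Rightarrow\Gamma'$, $Q\ge Q_0$ wherever $\Gamma$ holds, and $Q_0'\ge Q'$ wherever $\Gamma_0'$ holds. $\vdash\Delta$ means that $\Delta\vdash\{\Gamma;Q\}\,\mathscr D(f)\,\{\Gamma';Q'\}$ is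 derivable for every $f$ and every $(\Gamma;Q,\Gamma';Q')\in\Delta(f)$. **Theorem.** Let $d\ge 1$ be an integer. Suppose that $\vdash\Delta$ and $\Delta\vdash\{\Gamma;Q\}\,S_{\mathsf{main}}\,\{\Gamma';0\}$ have derivations in which every potential annotation is a polynomial in the program variables of total degree at most $d$, and that the initial valuation $\lambda\_.0$ satisfies $\Gamma$. Suppose further that 1. $\mathbb E[T^d]<\infty$, and 2. there is $C_0\ge0$ such that for all $n\ge0$ and $x\in\mathsf{VID}$, $|\gamma_{n+1}(x)-\gamma_n(x)|\le C_0$ almost surely. Then $T<\infty$ almost surely (so that $A_T$ is almost surely well defined), $A_T$ is integrable, and $$\mathbb E[A_T]\le Q(\lambda\_.0).$$ -/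

import Mathlib

open MeasureTheory ProbabilityTheory
open scoped ENNReal

set_option linter.unusedSectionVars false
set_option linter.flexible false

namespace Appl

universe u v w

/-- Arithmetic expressions over program variables in `V`. -/
inductive Expr (V : Type u) : Type u
  | var (x : V)
  | const (c : ℝ)
  | add (E₁ E₂ : Expr V)
  | mul (E₁ E₂ : Expr V)

/-- Conditions. -/
inductive Cond (V : Type u) : Type u
  | tt
  | neg (L : Cond V)
  | conj (L₁ L₂ : Cond V)
  | le (E₁ E₂ : Expr V)

/-- Primitive distributions: the uniform distributions on intervals, and an arbitrary further supply
`P` of distribution expressions (distribution names with their real parameters). -/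
inductive Dist (P : Type w) : Type w
  | uniform (a b : ℝ) (h : a < b)
  | prim (θ : P)

/-- Statements, over variables `V`, function identifiers `F` and further distributions `P`.
`loop L S` is `while L do S od`; `prob p S₁ S₂` executes `S₁` with probability `p`, else `S₂`. -/
inductive Stmt (V : Type u) (F : Type v) (P : Type w) : Type (max u v w)
  | skip
  | tick (c : ℝ)
  | assign (x : V) (E : Expr V)
  | sample (x : V) (D : Dist P)
  | call (f : F)
  | loop (L : Cond V) (S : Stmt V F P)
  | prob (p : unitInterval) (S₁ S₂ : Stmt V F P)
  | cond (L : Cond V) (S₁ S₂ : Stmt V F P)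
  | seq (S₁ S₂ : Stmt V F P)

/-- Continuations; `halt` is the empty continuation `Kstop`. -/
inductive Cont (V : Type u) (F : Type v) (P : Type w) : Type (max u v w)
  | halt
  | loop (L : Cond V) (S : Stmt V F P) (K : Cont V F P)
  | seq (S : Stmt V F P) (K : Cont V F P)

section Metric

/-! Extended metrics on syntax: syntax trees with the same skeleton are compared by the `ℓ¹` distance
of their real parameters, trees with different skeletons are infinitely far apart. -/

open Classical in
noncomputable def Expr.dist {V : Type u} : Expr V → Expr V → ℝ≥0∞
  | .var x, .var y => if x = y then 0 else ⊤
  | .const c₁, .const c₂ => edist c₁ c₂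
  | .add E₁₁ E₁₂, .add E₂₁ E₂₂ => E₁₁.dist E₂₁ + E₁₂.dist E₂₂
  | .mul E₁₁ E₁₂, .mul E₂₁ E₂₂ => E₁₁.dist E₂₁ + E₁₂.dist E₂₂
  | _, _ => ⊤

noncomputable def Cond.dist {V : Type u} : Cond V → Cond V → ℝ≥0∞
  | .tt, .tt => 0
  | .neg L₁, .neg L₂ => L₁.dist L₂
  | .conj L₁₁ L₁₂, .conj L₂₁ L₂₂ => L₁₁.dist L₂₁ + L₁₂.dist L₂₂
  | .le E₁₁ E₁₂, .le E₂₁ E₂₂ => E₁₁.dist E₂₁ + E₁₂.dist E₂₂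
  | _, _ => ⊤

noncomputable def Dist.dist {P : Type w} [EDist P] : Dist P → Dist P → ℝ≥0∞
  | .uniform a₁ b₁ _, .uniform a₂ b₂ _ => edist a₁ a₂ + edist b₁ b₂
  | .prim θ₁, .prim θ₂ => edist θ₁ θ₂
  | _, _ => ⊤

open Classical in
noncomputable def Stmt.dist {V : Type u} {F : Type v} {P : Type w} [EDist P] :
    Stmt V F P → Stmt V F P → ℝ≥0∞
  | .skip, .skip => 0
  | .tick c₁, .tick c₂ => edist c₁ c₂
  | .assign x E₁, .assign y E₂ => if x = y then E₁.dist E₂ else ⊤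
  | .sample x D₁, .sample y D₂ => if x = y then D₁.dist D₂ else ⊤
  | .call f, .call g => if f = g then 0 else ⊤
  | .loop L₁ S₁, .loop L₂ S₂ => L₁.dist L₂ + S₁.dist S₂
  | .prob p₁ S₁₁ S₁₂, .prob p₂ S₂₁ S₂₂ => edist p₁ p₂ + S₁₁.dist S₂₁ + S₁₂.dist S₂₂
  | .cond L₁ S₁₁ S₁₂, .cond L₂ S₂₁ S₂₂ => L₁.dist L₂ + S₁₁.dist S₂₁ + S₁₂.dist S₂₂
  | .seq S₁₁ S₁₂, .seq S₂₁ S₂₂ => S₁₁.dist S₂₁ + S₁₂.dist S₂₂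
  | _, _ => ⊤

noncomputable def Cont.dist {V : Type u} {F : Type v} {P : Type w} [EDist P] :
    Cont V F P → Cont V F P → ℝ≥0∞
  | .halt, .halt => 0
  | .loop L₁ S₁ K₁, .loop L₂ S₂ K₂ => L₁.dist L₂ + S₁.dist S₂ + K₁.dist K₂
  | .seq S₁ K₁, .seq S₂ K₂ => S₁.dist S₂ + K₁.dist K₂
  | _, _ => ⊤

theorem add_tri {a b c a' b' c' : ℝ≥0∞} (h : a ≤ b + c) (h' : a' ≤ b' + c') :
    a + a' ≤ (b + b') + (c + c') := by
  calc a + a' ≤ (b + c) + (b' + c') := add_le_add h h'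
    _ = _ := by ring

noncomputable instance {V : Type u} : EMetricSpace (Expr V) where
  edist := Expr.dist
  edist_self E := by
    induction E <;> simp_all [Expr.dist]
  edist_comm E := by
    induction E <;> intro E' <;> cases E' <;> simp_all [Expr.dist, edist_comm]
    split_ifs <;> simp_all
  edist_triangle E := by
    induction E with
    | var x =>
      intro E' E''
      cases E' <;> cases E'' <;> simp [Expr.dist]
      split_ifs <;> simp_all
    | const c =>
      intro E' E''
      cases E' <;> cases E'' <;> simp [Expr.dist, edist_triangle]
    | add _ _ h₁ h₂ =>
      intro E' E''
      cases E' <;> cases E'' <;> simp [Expr.dist, add_tri (h₁ _ _) (h₂ _ _)]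
    | mul _ _ h₁ h₂ =>
      intro E' E''
      cases E' <;> cases E'' <;> simp [Expr.dist, add_tri (h₁ _ _) (h₂ _ _)]
  eq_of_edist_eq_zero {E} := by
    induction E with
    | var x => intro E' h; cases E' <;> simp_all [Expr.dist]
    | const c =>
      intro E' h
      cases E' with
      | const c' => exact congrArg _ (eq_of_edist_eq_zero h)
      | _ => simp [Expr.dist] at h
    | add _ _ h₁ h₂ =>
      intro E' h
      cases E' with
      | add => rw [h₁ (add_eq_zero.1 h).1, h₂ (add_eq_zero.1 h).2]
      | _ => simp [Expr.dist] at h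
    | mul _ _ h₁ h₂ =>
      intro E' h
      cases E' with
      | mul => rw [h₁ (add_eq_zero.1 h).1, h₂ (add_eq_zero.1 h).2]
      | _ => simp [Expr.dist] at h

theorem Expr.edist_eq {V : Type u} (E E' : Expr V) : edist E E' = E.dist E' := rfl

noncomputable instance {V : Type u} : EMetricSpace (Cond V) where
  edist := Cond.dist
  edist_self L := by
    induction L <;> simp_all [Cond.dist, ← Expr.edist_eq]
  edist_comm L := by
    induction L <;> intro L' <;> cases L' <;> simp_all [Cond.dist, ← Expr.edist_eq, edist_comm]
  edist_triangle L := by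
    induction L with
    | tt => intro L' L''; cases L' <;> cases L'' <;> simp [Cond.dist]
    | neg _ h => intro L' L''; cases L' <;> cases L'' <;> simp [Cond.dist, h _ _]
    | conj _ _ h₁ h₂ =>
      intro L' L''
      cases L' <;> cases L'' <;> simp [Cond.dist, add_tri (h₁ _ _) (h₂ _ _)]
    | le E₁ E₂ =>
      intro L' L''
      cases L' <;> cases L'' <;>
        simp [Cond.dist, ← Expr.edist_eq, add_tri (edist_triangle _ _ _) (edist_triangle _ _ _)]
  eq_of_edist_eq_zero {L} := by
    induction L with
    | tt => intro L' h; cases L' <;> simp_all [Cond.dist]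
    | neg _ h₁ =>
      intro L' h
      cases L' with
      | neg => rw [h₁ h]
      | _ => simp [Cond.dist] at h
    | conj _ _ h₁ h₂ =>
      intro L' h
      cases L' with
      | conj => rw [h₁ (add_eq_zero.1 h).1, h₂ (add_eq_zero.1 h).2]
      | _ => simp [Cond.dist] at h
    | le E₁ E₂ =>
      intro L' h
      cases L' with
      | le =>
        simp [Cond.dist, ← Expr.edist_eq] at h
        rw [h.1, h.2]
      | _ => simp [Cond.dist] at h

theorem Cond.edist_eq {V : Type u} (L L' : Cond V) : edist L L' = L.dist L' := rfl

noncomputable instance {P : Type w} [EMetricSpace P] : EMetricSpace (Dist P) where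
  edist := Dist.dist
  edist_self D := by cases D <;> simp [Dist.dist]
  edist_comm D D' := by cases D <;> cases D' <;> simp [Dist.dist, edist_comm]
  edist_triangle D D' D'' := by
    cases D <;> cases D' <;> cases D'' <;>
      simp [Dist.dist, edist_triangle, add_tri (edist_triangle _ _ _) (edist_triangle _ _ _)]
  eq_of_edist_eq_zero {D D'} h := by
    cases D <;> cases D' <;> simp_all [Dist.dist]

theorem Dist.edist_eq {P : Type w} [EMetricSpace P] (D D' : Dist P) :
    edist D D' = D.dist D' := rfl

noncomputable instance {V : Type u} {F : Type v} {P : Type w} [EMetricSpace P] :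
    EMetricSpace (Stmt V F P) where
  edist := Stmt.dist
  edist_self S := by
    induction S <;> simp_all [Stmt.dist, ← Expr.edist_eq, ← Cond.edist_eq, ← Dist.edist_eq]
  edist_comm S := by
    induction S <;> intro S' <;> cases S' <;>
      simp_all [Stmt.dist, ← Expr.edist_eq, ← Cond.edist_eq, ← Dist.edist_eq, edist_comm] <;>
      (split_ifs <;> simp_all)
  edist_triangle S := by
    induction S with
    | skip => intro S' S''; cases S' <;> cases S'' <;> simp [Stmt.dist]
    | tick => intro S' S''; cases S' <;> cases S'' <;> simp [Stmt.dist, edist_triangle]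
    | assign =>
      intro S' S''
      cases S' <;> cases S'' <;> simp [Stmt.dist, ← Expr.edist_eq]
      split_ifs <;> simp_all [edist_triangle]
    | sample =>
      intro S' S''
      cases S' <;> cases S'' <;> simp [Stmt.dist, ← Dist.edist_eq]
      split_ifs <;> simp_all [edist_triangle]
    | call =>
      intro S' S''
      cases S' <;> cases S'' <;> simp [Stmt.dist]
      split_ifs <;> simp_all
    | loop _ _ h =>
      intro S' S''
      cases S' <;> cases S'' <;>
        simp [Stmt.dist, ← Cond.edist_eq, add_tri (edist_triangle _ _ _) (h _ _)]
    | prob _ _ _ h₁ h₂ =>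
      intro S' S''
      cases S' <;> cases S'' <;>
        simp [Stmt.dist, add_tri (add_tri (edist_triangle _ _ _) (h₁ _ _)) (h₂ _ _)]
    | cond _ _ _ h₁ h₂ =>
      intro S' S''
      cases S' <;> cases S'' <;>
        simp [Stmt.dist, ← Cond.edist_eq,
          add_tri (add_tri (edist_triangle _ _ _) (h₁ _ _)) (h₂ _ _)]
    | seq _ _ h₁ h₂ =>
      intro S' S''
      cases S' <;> cases S'' <;> simp [Stmt.dist, add_tri (h₁ _ _) (h₂ _ _)]
  eq_of_edist_eq_zero {S} := by
    induction S with
    | skip => intro S' h; cases S' <;> simp_all [Stmt.dist]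
    | tick => intro S' h; cases S' <;> simp_all [Stmt.dist]
    | assign =>
      intro S' h; cases S' <;> simp [Stmt.dist, ← Expr.edist_eq] at h
      split_ifs at h <;> simp_all
    | sample =>
      intro S' h; cases S' <;> simp [Stmt.dist, ← Dist.edist_eq] at h
      split_ifs at h <;> simp_all
    | call => intro S' h; cases S' <;> simp_all [Stmt.dist]
    | loop _ _ h₂ =>
      intro S' h
      cases S' <;> simp [Stmt.dist, ← Cond.edist_eq] at h
      rw [h.1, h₂ h.2]
    | prob _ _ _ h₁ h₂ =>
      intro S' h
      cases S' <;> simp [Stmt.dist] at h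
      rw [h.1.1, h₁ h.1.2, h₂ h.2]
    | cond _ _ _ h₁ h₂ =>
      intro S' h
      cases S' <;> simp [Stmt.dist, ← Cond.edist_eq] at h
      rw [h.1.1, h₁ h.1.2, h₂ h.2]
    | seq _ _ h₁ h₂ =>
      intro S' h
      cases S' <;> simp [Stmt.dist] at h
      rw [h₁ h.1, h₂ h.2]

theorem Stmt.edist_eq {V : Type u} {F : Type v} {P : Type w} [EMetricSpace P]
    (S S' : Stmt V F P) : edist S S' = S.dist S' := rfl

noncomputable instance {V : Type u} {F : Type v} {P : Type w} [EMetricSpace P] :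
    EMetricSpace (Cont V F P) where
  edist := Cont.dist
  edist_self K := by
    induction K <;> simp_all [Cont.dist, ← Cond.edist_eq, ← Stmt.edist_eq]
  edist_comm K := by
    induction K <;> intro K' <;> cases K' <;>
      simp_all [Cont.dist, ← Cond.edist_eq, ← Stmt.edist_eq, edist_comm]
  edist_triangle K := by
    induction K with
    | halt => intro K' K''; cases K' <;> cases K'' <;> simp [Cont.dist]
    | loop _ _ _ h =>
      intro K' K''
      cases K' <;> cases K'' <;>
        simp [Cont.dist, ← Cond.edist_eq, ← Stmt.edist_eq,
          add_tri (add_tri (edist_triangle _ _ _) (edist_triangle _ _ _)) (h _ _)]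
    | seq _ _ h =>
      intro K' K''
      cases K' <;> cases K'' <;>
        simp [Cont.dist, ← Stmt.edist_eq, add_tri (edist_triangle _ _ _) (h _ _)]
  eq_of_edist_eq_zero {K} := by
    induction K with
    | halt => intro K' h; cases K' <;> simp_all [Cont.dist]
    | loop _ _ _ h₂ =>
      intro K' h
      cases K' <;> simp [Cont.dist, ← Cond.edist_eq, ← Stmt.edist_eq] at h
      rw [h.1.1, h.1.2, h₂ h.2]
    | seq _ _ h₂ =>
      intro K' h
      cases K' <;> simp [Cont.dist, ← Stmt.edist_eq] at h
      rw [h.1, h₂ h.2]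

theorem Cont.edist_eq {V : Type u} {F : Type v} {P : Type w} [EMetricSpace P]
    (K K' : Cont V F P) : edist K K' = K.dist K' := rfl

end Metric

section Borel

/-! Syntax carries the Borel σ-algebras of these metrics. -/

variable {V : Type u} {F : Type v} {P : Type w}

noncomputable instance : MeasurableSpace (Expr V) := borel _
instance : BorelSpace (Expr V) := ⟨rfl⟩
noncomputable instance : MeasurableSpace (Cond V) := borel _
instance : BorelSpace (Cond V) := ⟨rfl⟩
noncomputable instance [EMetricSpace P] : MeasurableSpace (Dist P) := borel _
instance [EMetricSpace P] : BorelSpace (Dist P) := ⟨rfl⟩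
noncomputable instance [EMetricSpace P] : MeasurableSpace (Stmt V F P) := borel _
instance [EMetricSpace P] : BorelSpace (Stmt V F P) := ⟨rfl⟩
noncomputable instance [EMetricSpace P] : MeasurableSpace (Cont V F P) := borel _
instance [EMetricSpace P] : BorelSpace (Cont V F P) := ⟨rfl⟩

theorem isOpenEmbedding_of_edist {X : Type*} {Y : Type*} [EMetricSpace X] [EMetricSpace Y]
    (c : X → Y) (h₁ : ∀ x x', edist (c x) (c x') ≤ 3 * edist x x')
    (h₂ : ∀ x x', edist x x' ≤ edist (c x) (c x'))
    (h₃ : ∀ x y, edist y (c x) ≠ ⊤ → y ∈ Set.range c) : Topology.IsOpenEmbedding c := by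
  have hl : LipschitzWith 3 c := fun x x' => h₁ x x'
  have ha : AntilipschitzWith 1 c := fun x x' => by simpa using h₂ x x'
  refine ⟨(ha.isUniformEmbedding hl.uniformContinuous).isEmbedding, ?_⟩
  rw [EMetric.isOpen_iff]
  rintro _ ⟨x, rfl⟩
  exact ⟨1, one_pos, fun y hy => h₃ x y (ne_top_of_lt hy)⟩

theorem le_three_mul (a : ℝ≥0∞) : a ≤ 3 * a := by
  calc a = 1 * a := (one_mul a).symm
    _ ≤ 3 * a := by gcongr; norm_num

theorem add_le_three_max (a b : ℝ≥0∞) : a + b ≤ 3 * max a b := by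
  calc a + b ≤ max a b + max a b := add_le_add (le_max_left _ _) (le_max_right _ _)
    _ = 2 * max a b := (two_mul _).symm
    _ ≤ 3 * max a b := by gcongr; norm_num

theorem add_le_three_max' (a b c : ℝ≥0∞) : a + b + c ≤ 3 * max a (max b c) := by
  calc a + b + c ≤ max a (max b c) + max a (max b c) + max a (max b c) := by
        gcongr <;> simp
    _ = 3 * max a (max b c) := by ring

theorem max_le_add' (a b c : ℝ≥0∞) : max a (max b c) ≤ a + b + c :=
  max_le (le_add_right le_self_add) (max_le (le_add_right le_add_self) le_add_self)

theorem max_le_add (a b : ℝ≥0∞) : max a b ≤ a + b := max_le le_self_add le_add_self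

theorem Expr.oe_var (x : V) : Topology.IsOpenEmbedding (fun _ : Unit => Expr.var x) := by
  refine isOpenEmbedding_of_edist _ (by simp) (by simp) ?_
  rintro - y h
  cases y <;> simp [Expr.edist_eq, Expr.dist] at h ⊢
  exact h

theorem Expr.oe_const : Topology.IsOpenEmbedding (Expr.const (V := V)) := by
  refine isOpenEmbedding_of_edist _ (fun x x' => le_three_mul _) (fun x x' => le_rfl) ?_
  rintro x y h
  cases y <;> simp [Expr.edist_eq, Expr.dist] at h ⊢

theorem Expr.oe_add : Topology.IsOpenEmbedding (fun e : Expr V × Expr V => e.1.add e.2) := by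
  refine isOpenEmbedding_of_edist _ (fun x x' => add_le_three_max _ _)
    (fun x x' => max_le_add _ _) ?_
  rintro x y h
  cases y <;> simp [Expr.edist_eq, Expr.dist] at h ⊢

theorem Expr.oe_mul : Topology.IsOpenEmbedding (fun e : Expr V × Expr V => e.1.mul e.2) := by
  refine isOpenEmbedding_of_edist _ (fun x x' => add_le_three_max _ _)
    (fun x x' => max_le_add _ _) ?_
  rintro x y h
  cases y <;> simp [Expr.edist_eq, Expr.dist] at h ⊢

theorem Cond.oe_tt : Topology.IsOpenEmbedding (fun _ : Unit => Cond.tt (V := V)) := by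
  refine isOpenEmbedding_of_edist _ (by simp) (by simp) ?_
  rintro - y h
  cases y <;> simp [Cond.edist_eq, Cond.dist] at h ⊢

theorem Cond.oe_neg : Topology.IsOpenEmbedding (Cond.neg (V := V)) := by
  refine isOpenEmbedding_of_edist _ (fun x x' => le_three_mul _) (fun x x' => le_rfl) ?_
  rintro x y h
  cases y <;> simp [Cond.edist_eq, Cond.dist] at h ⊢

theorem Cond.oe_conj : Topology.IsOpenEmbedding (fun e : Cond V × Cond V => e.1.conj e.2) := by
  refine isOpenEmbedding_of_edist _ (fun x x' => add_le_three_max _ _)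
    (fun x x' => max_le_add _ _) ?_
  rintro x y h
  cases y <;> simp [Cond.edist_eq, Cond.dist] at h ⊢

theorem Cond.oe_le : Topology.IsOpenEmbedding (fun e : Expr V × Expr V => Cond.le e.1 e.2) := by
  refine isOpenEmbedding_of_edist _ (fun x x' => add_le_three_max _ _)
    (fun x x' => max_le_add _ _) ?_
  rintro x y h
  cases y <;> simp [Cond.edist_eq, Cond.dist] at h ⊢

theorem Dist.oe_uniform [EMetricSpace P] : Topology.IsOpenEmbedding
    (fun q : {q : ℝ × ℝ // q.1 < q.2} => Dist.uniform (P := P) q.1.1 q.1.2 q.2) := by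
  refine isOpenEmbedding_of_edist _ (fun x x' => add_le_three_max _ _)
    (fun x x' => max_le_add _ _) ?_
  rintro x y h
  cases y <;> simp [Dist.edist_eq, Dist.dist] at h ⊢
  assumption

theorem Dist.oe_prim [EMetricSpace P] : Topology.IsOpenEmbedding (Dist.prim (P := P)) := by
  refine isOpenEmbedding_of_edist _ (fun x x' => le_three_mul _) (fun x x' => le_rfl) ?_
  rintro x y h
  cases y <;> simp [Dist.edist_eq, Dist.dist] at h ⊢

theorem Stmt.oe_skip [EMetricSpace P] :
    Topology.IsOpenEmbedding (fun _ : Unit => Stmt.skip (V := V) (F := F) (P := P)) := by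
  refine isOpenEmbedding_of_edist _ (by simp) (by simp) ?_
  rintro - y h
  cases y <;> simp [Stmt.edist_eq, Stmt.dist] at h ⊢

theorem Stmt.oe_tick [EMetricSpace P] :
    Topology.IsOpenEmbedding (Stmt.tick (V := V) (F := F) (P := P)) := by
  refine isOpenEmbedding_of_edist _ (fun x x' => le_three_mul _) (fun x x' => le_rfl) ?_
  rintro x y h
  cases y <;> simp [Stmt.edist_eq, Stmt.dist] at h ⊢

theorem Stmt.oe_assign [EMetricSpace P] (x : V) :
    Topology.IsOpenEmbedding (Stmt.assign (V := V) (F := F) (P := P) x) := by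
  refine isOpenEmbedding_of_edist _ (fun x x' => ?_) (fun x x' => ?_) ?_
  · simpa [Stmt.edist_eq, Stmt.dist, Expr.edist_eq] using le_three_mul _
  · simp [Stmt.edist_eq, Stmt.dist, Expr.edist_eq]
  rintro x y h
  cases y <;> simp [Stmt.edist_eq, Stmt.dist] at h ⊢
  exact h.1.symm

theorem Stmt.oe_sample [EMetricSpace P] (x : V) :
    Topology.IsOpenEmbedding (Stmt.sample (V := V) (F := F) (P := P) x) := by
  refine isOpenEmbedding_of_edist _ (fun x x' => ?_) (fun x x' => ?_) ?_
  · simpa [Stmt.edist_eq, Stmt.dist, Dist.edist_eq] using le_three_mul _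
  · simp [Stmt.edist_eq, Stmt.dist, Dist.edist_eq]
  rintro x y h
  cases y <;> simp [Stmt.edist_eq, Stmt.dist] at h ⊢
  exact h.1.symm

theorem Stmt.oe_call [EMetricSpace P] (f : F) :
    Topology.IsOpenEmbedding (fun _ : Unit => Stmt.call (V := V) (F := F) (P := P) f) := by
  refine isOpenEmbedding_of_edist _ (by simp) (by simp) ?_
  rintro - y h
  cases y <;> simp [Stmt.edist_eq, Stmt.dist] at h ⊢
  exact h

theorem Stmt.oe_loop [EMetricSpace P] : Topology.IsOpenEmbedding
    (fun q : Cond V × Stmt V F P => Stmt.loop q.1 q.2) := by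
  refine isOpenEmbedding_of_edist _ (fun x x' => add_le_three_max _ _)
    (fun x x' => max_le_add _ _) ?_
  rintro x y h
  cases y <;> simp [Stmt.edist_eq, Stmt.dist] at h ⊢

theorem Stmt.oe_prob [EMetricSpace P] : Topology.IsOpenEmbedding
    (fun q : unitInterval × Stmt V F P × Stmt V F P => Stmt.prob q.1 q.2.1 q.2.2) := by
  refine isOpenEmbedding_of_edist _ (fun x x' => add_le_three_max' _ _ _)
    (fun x x' => max_le_add' _ _ _) ?_
  rintro x y h
  cases y <;> simp [Stmt.edist_eq, Stmt.dist] at h ⊢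

theorem Stmt.oe_cond [EMetricSpace P] : Topology.IsOpenEmbedding
    (fun q : Cond V × Stmt V F P × Stmt V F P => Stmt.cond q.1 q.2.1 q.2.2) := by
  refine isOpenEmbedding_of_edist _ (fun x x' => add_le_three_max' _ _ _)
    (fun x x' => max_le_add' _ _ _) ?_
  rintro x y h
  cases y <;> simp [Stmt.edist_eq, Stmt.dist] at h ⊢

theorem Stmt.oe_seq [EMetricSpace P] : Topology.IsOpenEmbedding
    (fun q : Stmt V F P × Stmt V F P => Stmt.seq q.1 q.2) := by
  refine isOpenEmbedding_of_edist _ (fun x x' => add_le_three_max _ _)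
    (fun x x' => max_le_add _ _) ?_
  rintro x y h
  cases y <;> simp [Stmt.edist_eq, Stmt.dist] at h ⊢

theorem Cont.oe_halt [EMetricSpace P] :
    Topology.IsOpenEmbedding (fun _ : Unit => Cont.halt (V := V) (F := F) (P := P)) := by
  refine isOpenEmbedding_of_edist _ (by simp) (by simp) ?_
  rintro - y h
  cases y <;> simp [Cont.edist_eq, Cont.dist] at h ⊢

theorem Cont.oe_loop [EMetricSpace P] : Topology.IsOpenEmbedding
    (fun q : Cond V × Stmt V F P × Cont V F P => Cont.loop q.1 q.2.1 q.2.2) := by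
  refine isOpenEmbedding_of_edist _ (fun x x' => add_le_three_max' _ _ _)
    (fun x x' => max_le_add' _ _ _) ?_
  rintro x y h
  cases y <;> simp [Cont.edist_eq, Cont.dist] at h ⊢

theorem Cont.oe_seq [EMetricSpace P] : Topology.IsOpenEmbedding
    (fun q : Stmt V F P × Cont V F P => Cont.seq q.1 q.2) := by
  refine isOpenEmbedding_of_edist _ (fun x x' => add_le_three_max _ _)
    (fun x x' => max_le_add _ _) ?_
  rintro x y h
  cases y <;> simp [Cont.edist_eq, Cont.dist] at h ⊢

section Separable
open TopologicalSpace

instance [Countable V] : SecondCountableTopology (Expr V) := by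
  have key : ∀ n, IsSeparable {E : Expr V | sizeOf E ≤ n} := by
    intro n
    induction n with
    | zero =>
      refine IsSeparable.mono (Set.countable_empty.isSeparable) ?_
      intro E hE
      cases E <;> simp at hE
    | succ n ih =>
      refine IsSeparable.mono (((Set.countable_range Expr.var).isSeparable.union
        (isSeparable_range Expr.oe_const.continuous)).union
        (((ih.prod ih).image Expr.oe_add.continuous).union
          ((ih.prod ih).image Expr.oe_mul.continuous))) ?_
      intro E hE
      cases E <;> simp at hE ⊢ <;> omega
  have h : IsSeparable (Set.univ : Set (Expr V)) :=
    (IsSeparable.iUnion key).mono fun E _ => Set.mem_iUnion.2 ⟨sizeOf E, le_refl (sizeOf E)⟩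
  have := isSeparable_univ_iff.1 h
  exact UniformSpace.secondCountable_of_separable _

instance [Countable V] : SecondCountableTopology (Cond V) := by
  have key : ∀ n, IsSeparable {L : Cond V | sizeOf L ≤ n} := by
    intro n
    induction n with
    | zero =>
      refine IsSeparable.mono (Set.countable_empty.isSeparable) ?_
      intro E hE
      cases E <;> simp at hE
    | succ n ih =>
      refine IsSeparable.mono (((Set.countable_singleton Cond.tt).isSeparable.union
        (isSeparable_range Cond.oe_le.continuous)).union
        ((ih.image Cond.oe_neg.continuous).union
          ((ih.prod ih).image Cond.oe_conj.continuous))) ?_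
      intro E hE
      cases E <;> simp at hE ⊢ <;> omega
  have h : IsSeparable (Set.univ : Set (Cond V)) :=
    (IsSeparable.iUnion key).mono fun E _ => Set.mem_iUnion.2 ⟨sizeOf E, le_refl (sizeOf E)⟩
  have := isSeparable_univ_iff.1 h
  exact UniformSpace.secondCountable_of_separable _

variable [EMetricSpace P] [SecondCountableTopology P]

instance : SecondCountableTopology (Dist P) := by
  have h : IsSeparable (Set.univ : Set (Dist P)) := by
    refine ((isSeparable_range Dist.oe_uniform.continuous).union
      (isSeparable_range Dist.oe_prim.continuous)).mono ?_
    intro D _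
    cases D <;> simp
    assumption
  have := isSeparable_univ_iff.1 h
  exact UniformSpace.secondCountable_of_separable _

instance [Countable V] [Countable F] : SecondCountableTopology (Stmt V F P) := by
  have key : ∀ n, IsSeparable {S : Stmt V F P | sizeOf S ≤ n} := by
    intro n
    induction n with
    | zero =>
      refine IsSeparable.mono (Set.countable_empty.isSeparable) ?_
      intro E hE
      cases E <;> simp at hE
    | succ n ih =>
      refine IsSeparable.mono (((Set.countable_singleton Stmt.skip).isSeparable.union
        (isSeparable_range Stmt.oe_tick.continuous)).union
        (((IsSeparable.iUnion fun x => isSeparable_range (Stmt.oe_assign x).continuous).union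
          (IsSeparable.iUnion fun x => isSeparable_range (Stmt.oe_sample x).continuous)).union
        (((Set.countable_range Stmt.call).isSeparable.union
          (((IsSeparable.of_separableSpace Set.univ).prod ih).image Stmt.oe_loop.continuous)).union
        ((((IsSeparable.of_separableSpace Set.univ).prod (ih.prod ih)).image
            Stmt.oe_prob.continuous).union
        ((((IsSeparable.of_separableSpace Set.univ).prod (ih.prod ih)).image
            Stmt.oe_cond.continuous).union
          ((ih.prod ih).image Stmt.oe_seq.continuous)))))) ?_
      intro E hE
      cases E <;> simp at hE ⊢ <;> omega
  have h : IsSeparable (Set.univ : Set (Stmt V F P)) :=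
    (IsSeparable.iUnion key).mono fun E _ => Set.mem_iUnion.2 ⟨sizeOf E, le_refl (sizeOf E)⟩
  have := isSeparable_univ_iff.1 h
  exact UniformSpace.secondCountable_of_separable _

instance [Countable V] [Countable F] : SecondCountableTopology (Cont V F P) := by
  have key : ∀ n, IsSeparable {S : Cont V F P | sizeOf S ≤ n} := by
    intro n
    induction n with
    | zero =>
      refine IsSeparable.mono (Set.countable_empty.isSeparable) ?_
      intro E hE
      cases E <;> simp at hE
    | succ n ih =>
      refine IsSeparable.mono ((Set.countable_singleton Cont.halt).isSeparable.union
        ((((IsSeparable.of_separableSpace Set.univ).prod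
            ((IsSeparable.of_separableSpace Set.univ).prod ih)).image Cont.oe_loop.continuous).union
          (((IsSeparable.of_separableSpace Set.univ).prod ih).image Cont.oe_seq.continuous))) ?_
      intro E hE
      cases E <;> simp at hE ⊢ <;> omega
  have h : IsSeparable (Set.univ : Set (Cont V F P)) :=
    (IsSeparable.iUnion key).mono fun E _ => Set.mem_iUnion.2 ⟨sizeOf E, le_refl (sizeOf E)⟩
  have := isSeparable_univ_iff.1 h
  exact UniformSpace.secondCountable_of_separable _

end Separable

end Borel
section Semantics

variable {V : Type u} {F : Type v} {P : Type w}

/-- The value `r` with `γ ⊢ E ⇓ r`. -/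
def Expr.eval (γ : V → ℝ) : Expr V → ℝ
  | .var x => γ x
  | .const c => c
  | .add E₁ E₂ => E₁.eval γ + E₂.eval γ
  | .mul E₁ E₂ => E₁.eval γ * E₂.eval γ

/-- Truth of the condition `L` at `γ`, i.e. `γ ⊢ L ⇓ ⊤`. -/
def Cond.eval (γ : V → ℝ) : Cond V → Prop
  | .tt => True
  | .neg L => ¬ L.eval γ
  | .conj L₁ L₂ => L₁.eval γ ∧ L₂.eval γ
  | .le E₁ E₂ => E₁.eval γ ≤ E₂.eval γ

/-- The measure with density `[a ≤ x ≤ b] / (b - a)`. -/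
noncomputable def uniformMeasure (a b : ℝ) : Measure ℝ :=
  volume.withDensity fun x =>
    ENNReal.ofReal ((Set.Icc a b).indicator (fun _ => 1 / (b - a)) x)

/-- The probability measure `μ_D` of a distribution `D`. -/
noncomputable def Dist.measure [MeasurableSpace P] (ϑ : Kernel P ℝ) : Dist P → Measure ℝ
  | .uniform a b _ => uniformMeasure a b
  | .prim θ => ϑ θ

/-- Program configurations `⟨γ, S, K, α⟩`, with the product σ-algebra. -/
abbrev Config (V : Type u) (F : Type v) (P : Type w) : Type (max u v w) :=
  (V → ℝ) × Stmt V F P × Cont V F P × ℝ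

open Classical in
/-- The distribution `μ` with `σ ↦ μ`, for function bodies `𝒟`: one evaluation step. -/
noncomputable def step [DecidableEq V] [EMetricSpace P] [MeasurableSpace P] (ϑ : Kernel P ℝ)
    (𝒟 : F → Stmt V F P) : Config V F P → Measure (Config V F P)
  | (γ, .skip, .halt, α) => Measure.dirac (γ, .skip, .halt, α)
  | (γ, .skip, .loop L S K, α) =>
      if L.eval γ then Measure.dirac (γ, S, .loop L S K, α) else Measure.dirac (γ, .skip, K, α)
  | (γ, .skip, .seq S K, α) => Measure.dirac (γ, S, K, α)
  | (γ, .tick c, K, α) => Measure.dirac (γ, .skip, K, α + c)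
  | (γ, .assign x E, K, α) => Measure.dirac (Function.update γ x (E.eval γ), .skip, K, α)
  | (γ, .sample x D, K, α) =>
      (D.measure ϑ).bind fun r => Measure.dirac (Function.update γ x r, .skip, K, α)
  | (γ, .call f, K, α) => Measure.dirac (γ, 𝒟 f, K, α)
  | (γ, .prob p S₁ S₂, K, α) =>
      ENNReal.ofReal p • Measure.dirac (γ, S₁, K, α) +
        ENNReal.ofReal (1 - p) • Measure.dirac (γ, S₂, K, α)
  | (γ, .cond L S₁ S₂, K, α) =>
      if L.eval γ then Measure.dirac (γ, S₁, K, α) else Measure.dirac (γ, S₂, K, α)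
  | (γ, .loop L S, K, α) => Measure.dirac (γ, .skip, .loop L S K, α)
  | (γ, .seq S₁ S₂, K, α) => Measure.dirac (γ, S₁, .seq S₂ K, α)

theorem Expr.continuous_eval : Continuous fun q : (V → ℝ) × Expr V => q.2.eval q.1 := by
  rw [continuous_iff_continuousAt]
  rintro ⟨γ, E⟩
  induction E with
  | var x =>
    have h := ((Topology.IsOpenEmbedding.id (X := V → ℝ)).prodMap (Expr.oe_var x)).continuousAt_iff
      (g := fun q : (V → ℝ) × Expr V => q.2.eval q.1) (x := (γ, ()))
    refine h.1 ?_
    change ContinuousAt (fun q : (V → ℝ) × Unit => q.1 x) (γ, ())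
    fun_prop
  | const c =>
    have h := ((Topology.IsOpenEmbedding.id (X := V → ℝ)).prodMap (Expr.oe_const)).continuousAt_iff
      (g := fun q : (V → ℝ) × Expr V => q.2.eval q.1) (x := (γ, c))
    refine h.1 ?_
    change ContinuousAt (fun q : (V → ℝ) × ℝ => q.2) (γ, c)
    fun_prop
  | add E₁ E₂ h₁ h₂ =>
    have h := ((Topology.IsOpenEmbedding.id (X := V → ℝ)).prodMap (Expr.oe_add)).continuousAt_iff
      (g := fun q : (V → ℝ) × Expr V => q.2.eval q.1) (x := (γ, E₁, E₂))
    refine h.1 ?_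
    change ContinuousAt (fun q : (V → ℝ) × Expr V × Expr V => q.2.1.eval q.1 + q.2.2.eval q.1)
      (γ, E₁, E₂)
    exact (ContinuousAt.comp_of_eq (f := fun q : (V → ℝ) × Expr V × Expr V => (q.1, q.2.1)) h₁
      (by fun_prop) rfl).add
      (ContinuousAt.comp_of_eq (f := fun q : (V → ℝ) × Expr V × Expr V => (q.1, q.2.2)) h₂
      (by fun_prop) rfl)
  | mul E₁ E₂ h₁ h₂ =>
    have h := ((Topology.IsOpenEmbedding.id (X := V → ℝ)).prodMap (Expr.oe_mul)).continuousAt_iff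
      (g := fun q : (V → ℝ) × Expr V => q.2.eval q.1) (x := (γ, E₁, E₂))
    refine h.1 ?_
    change ContinuousAt (fun q : (V → ℝ) × Expr V × Expr V => q.2.1.eval q.1 * q.2.2.eval q.1)
      (γ, E₁, E₂)
    exact (ContinuousAt.comp_of_eq (f := fun q : (V → ℝ) × Expr V × Expr V => (q.1, q.2.1)) h₁
      (by fun_prop) rfl).mul
      (ContinuousAt.comp_of_eq (f := fun q : (V → ℝ) × Expr V × Expr V => (q.1, q.2.2)) h₂
      (by fun_prop) rfl)

theorem Expr.measurable_eval [Countable V] :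
    Measurable fun q : (V → ℝ) × Expr V => q.2.eval q.1 :=
  Expr.continuous_eval.measurable

theorem Cond.measurableSet_eval [Countable V] :
    MeasurableSet {q : (V → ℝ) × Cond V | q.2.eval q.1} := by
  have key : ∀ L₀ : Cond V, ∃ U : Set (Cond V), IsOpen U ∧ L₀ ∈ U ∧
      MeasurableSet {q : (V → ℝ) × Cond V | q.2 ∈ U ∧ q.2.eval q.1} := by
    have me {X : Type u} [TopologicalSpace X] [SecondCountableTopology X] [MeasurableSpace X]
        [BorelSpace X] {c : X → Cond V} (hc : Topology.IsOpenEmbedding c) :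
        MeasurableEmbedding (Prod.map (id : (V → ℝ) → _) c) :=
      MeasurableEmbedding.id.prodMap hc.measurableEmbedding
    intro L₀
    induction L₀ with
    | tt =>
      refine ⟨_, Cond.oe_tt.isOpen_range, ⟨(), rfl⟩, ?_⟩
      have : {q : (V → ℝ) × Cond V | q.2 ∈ Set.range (fun _ : Unit => Cond.tt) ∧ q.2.eval q.1} =
          Prod.snd ⁻¹' Set.range (fun _ : Unit => Cond.tt (V := V)) := by
        ext ⟨γ, L⟩
        cases L <;> simp [Cond.eval]
      rw [this]
      exact Cond.oe_tt.isOpen_range.measurableSet.preimage measurable_snd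
    | neg L ih =>
      obtain ⟨U, hU, hL, hm⟩ := ih
      refine ⟨_, Cond.oe_neg.isOpenMap U hU, ⟨L, hL, rfl⟩, ?_⟩
      have : {q : (V → ℝ) × Cond V | q.2 ∈ Cond.neg '' U ∧ q.2.eval q.1} =
          Prod.map id Cond.neg '' ((Prod.snd ⁻¹' U) \ {q | q.2 ∈ U ∧ q.2.eval q.1}) := by
        ext ⟨γ, L⟩
        cases L <;> simp [Cond.eval]
        tauto
      rw [this]
      exact (me Cond.oe_neg).measurableSet_image' ((hU.measurableSet.preimage measurable_snd).diff hm)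
    | conj L₁ L₂ ih₁ ih₂ =>
      obtain ⟨U₁, hU₁, hL₁, hm₁⟩ := ih₁
      obtain ⟨U₂, hU₂, hL₂, hm₂⟩ := ih₂
      refine ⟨_, Cond.oe_conj.isOpenMap _ (hU₁.prod hU₂), ⟨(L₁, L₂), ⟨hL₁, hL₂⟩, rfl⟩, ?_⟩
      have : {q : (V → ℝ) × Cond V |
            q.2 ∈ (fun e : Cond V × Cond V => e.1.conj e.2) '' (U₁ ×ˢ U₂) ∧ q.2.eval q.1} =
          Prod.map id (fun e : Cond V × Cond V => e.1.conj e.2) ''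
            (((fun q => (q.1, q.2.1)) ⁻¹' {q | q.2 ∈ U₁ ∧ q.2.eval q.1}) ∩
            ((fun q => (q.1, q.2.2)) ⁻¹' {q | q.2 ∈ U₂ ∧ q.2.eval q.1})) := by
        ext ⟨γ, L⟩
        cases L <;> simp [Cond.eval]
        tauto
      rw [this]
      exact (me Cond.oe_conj).measurableSet_image'
        ((hm₁.preimage (by fun_prop)).inter (hm₂.preimage (by fun_prop)))
    | le E₁ E₂ =>
      refine ⟨_, Cond.oe_le.isOpen_range, ⟨(E₁, E₂), rfl⟩, ?_⟩
      have : {q : (V → ℝ) × Cond V |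
            q.2 ∈ Set.range (fun e : Expr V × Expr V => Cond.le e.1 e.2) ∧ q.2.eval q.1} =
          Prod.map id (fun e : Expr V × Expr V => Cond.le e.1 e.2) ''
            {q | q.2.1.eval q.1 ≤ q.2.2.eval q.1} := by
        ext ⟨γ, L⟩
        cases L <;> simp [Cond.eval]
      rw [this]
      refine (me Cond.oe_le).measurableSet_image' (measurableSet_le ?_ ?_)
      · exact Expr.measurable_eval.comp (measurable_fst.prodMk (measurable_fst.comp measurable_snd))
      · exact Expr.measurable_eval.comp (measurable_fst.prodMk (measurable_snd.comp measurable_snd))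
  choose U hU hL hm using key
  obtain ⟨s, hs, hcov⟩ := TopologicalSpace.countable_cover_nhds
    (fun L => (hU L).mem_nhds (hL L))
  have : {q : (V → ℝ) × Cond V | q.2.eval q.1} =
      ⋃ L ∈ s, {q : (V → ℝ) × Cond V | q.2 ∈ U L ∧ q.2.eval q.1} := by
    ext ⟨γ, L⟩
    have hL' : L ∈ ⋃ x ∈ s, U x := hcov ▸ Set.mem_univ L
    simp only [Set.mem_iUnion, Set.mem_ofPred_eq, exists_prop] at hL' ⊢
    exact ⟨fun h => let ⟨i, hi, hi'⟩ := hL'; ⟨i, hi, hi', h⟩, fun ⟨_, _, _, h⟩ => h⟩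
  rw [this]
  exact MeasurableSet.biUnion hs fun L _ => hm L

theorem lintegral_uniform {a b : ℝ} (h : a < b) :
    ∫⁻ x, ENNReal.ofReal ((Set.Icc a b).indicator (fun _ => 1 / (b - a)) x) = 1 := by
  have : (fun x => ENNReal.ofReal ((Set.Icc a b).indicator (fun _ => 1 / (b - a)) x)) =
      (Set.Icc a b).indicator (fun _ => ENNReal.ofReal (1 / (b - a))) := by
    ext x
    by_cases hx : x ∈ Set.Icc a b <;> simp [hx]
  rw [this, lintegral_indicator_const measurableSet_Icc, Real.volume_Icc,
    ← ENNReal.ofReal_mul (by have := sub_pos.2 h; positivity),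
    one_div_mul_cancel (sub_pos.2 h).ne', ENNReal.ofReal_one]

instance Dist.isProbabilityMeasure_measure [MeasurableSpace P] (ϑ : Kernel P ℝ)
    [IsMarkovKernel ϑ] (D : Dist P) : IsProbabilityMeasure (D.measure ϑ) := by
  cases D with
  | uniform a b h =>
    constructor
    rw [Dist.measure, uniformMeasure, withDensity_apply _ MeasurableSet.univ,
      Measure.restrict_univ, lintegral_uniform h]
  | prim θ => exact IsMarkovKernel.isProbabilityMeasure θ

/-- Auxiliary: `f` is measurable on the set `s`. -/
def MeasOn {α β : Type*} [MeasurableSpace α] [MeasurableSpace β] (f : α → β) (s : Set α) : Prop :=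
  ∀ B, MeasurableSet B → MeasurableSet (s ∩ f ⁻¹' B)

theorem MeasOn.union {α β : Type*} [MeasurableSpace α] [MeasurableSpace β] {f : α → β}
    {s t : Set α} (hs : MeasOn f s) (ht : MeasOn f t) : MeasOn f (s ∪ t) := fun B hB => by
  rw [Set.union_inter_distrib_right]
  exact (hs B hB).union (ht B hB)

theorem MeasOn.iUnion {α β ι : Type*} [MeasurableSpace α] [MeasurableSpace β] [Countable ι]
    {f : α → β} {s : ι → Set α} (hs : ∀ i, MeasOn f (s i)) : MeasOn f (⋃ i, s i) :=
  fun B hB => by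
    rw [Set.iUnion_inter]
    exact MeasurableSet.iUnion fun i => hs i B hB

theorem MeasOn.range {α β γ : Type*} [MeasurableSpace α] [MeasurableSpace β] [MeasurableSpace γ]
    {f : α → β} {e : γ → α} (he : MeasurableEmbedding e) (hf : Measurable (f ∘ e)) :
    MeasOn f (Set.range e) := fun B hB => by
  have : Set.range e ∩ f ⁻¹' B = e '' ((f ∘ e) ⁻¹' B) := by
    rw [Set.preimage_comp, Set.image_preimage_eq_range_inter]
  rw [this]
  exact he.measurableSet_image' (hf hB)

theorem MeasOn.measurable {α β : Type*} [MeasurableSpace α] [MeasurableSpace β]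
    {f : α → β} {s : Set α} (h : MeasOn f s) (hs : ∀ a, a ∈ s) : Measurable f := fun B hB => by
  have := h B hB
  rwa [Set.eq_univ_of_forall hs, Set.univ_inter] at this

variable [EMetricSpace P] [SecondCountableTopology P] [MeasurableSpace P] [BorelSpace P]

theorem Dist.measurable_measure (ϑ : Kernel P ℝ) : Measurable (Dist.measure ϑ) := by
  have h₁ : MeasOn (Dist.measure ϑ) _ := MeasOn.range Dist.oe_uniform.measurableEmbedding (by
    refine Measure.measurable_of_measurable_coe _ fun B hB => ?_
    simp only [Function.comp_def, Dist.measure, uniformMeasure, withDensity_apply _ hB]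
    refine Measurable.lintegral_prod_right'
      (f := fun (z : {q : ℝ × ℝ // q.1 < q.2} × ℝ) =>
        ENNReal.ofReal ((Set.Icc z.1.1.1 z.1.1.2).indicator (fun _ => 1 / (z.1.1.2 - z.1.1.1)) z.2)) ?_
    refine ENNReal.measurable_ofReal.comp ?_
    have : (fun z : {q : ℝ × ℝ // q.1 < q.2} × ℝ =>
        (Set.Icc z.1.1.1 z.1.1.2).indicator (fun _ => 1 / (z.1.1.2 - z.1.1.1)) z.2) =
        {z : {q : ℝ × ℝ // q.1 < q.2} × ℝ | z.1.1.1 ≤ z.2 ∧ z.2 ≤ z.1.1.2}.indicator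
          (fun z => 1 / (z.1.1.2 - z.1.1.1)) := rfl
    rw [this]
    refine Measurable.indicator (by fun_prop) ?_
    have hl : Measurable fun z : {q : ℝ × ℝ // q.1 < q.2} × ℝ => z.1.1.1 := by fun_prop
    have hr : Measurable fun z : {q : ℝ × ℝ // q.1 < q.2} × ℝ => z.1.1.2 := by fun_prop
    exact (measurableSet_le hl measurable_snd).inter (measurableSet_le measurable_snd hr))
  have h₂ : MeasOn (Dist.measure ϑ) _ := MeasOn.range Dist.oe_prim.measurableEmbedding ϑ.measurable
  refine (h₁.union h₂).measurable fun D => ?_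
  cases D <;> simp
  assumption

theorem me_stmt [Countable V] [Countable F] {X : Type*} [TopologicalSpace X]
    [MeasurableSpace X] [BorelSpace X] {c : X → Stmt V F P} (hc : Topology.IsOpenEmbedding c) :
    MeasurableEmbedding
      (Prod.map (id : (V → ℝ) → _) (Prod.map c (id : Cont V F P × ℝ → _))) :=
  MeasurableEmbedding.id.prodMap (hc.measurableEmbedding.prodMap MeasurableEmbedding.id)

theorem me_cont [Countable V] [Countable F] {X : Type*} [TopologicalSpace X]
    [MeasurableSpace X] [BorelSpace X] {c : X → Cont V F P} (hc : Topology.IsOpenEmbedding c) :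
    MeasurableEmbedding
      (Prod.map (id : (V → ℝ) → _) (Prod.map (fun _ : Unit => (Stmt.skip : Stmt V F P))
        (Prod.map c (id : ℝ → _)))) :=
  MeasurableEmbedding.id.prodMap
    (Stmt.oe_skip.measurableEmbedding.prodMap (hc.measurableEmbedding.prodMap
      MeasurableEmbedding.id))

theorem step_measurable [Finite V] [DecidableEq V] [Countable F] (ϑ : Kernel P ℝ)
    [IsMarkovKernel ϑ] (𝒟 : F → Stmt V F P) : Measurable (step ϑ 𝒟) := by
  have h_loop : Measurable fun q : Cond V × Stmt V F P × Cont V F P => Cont.loop q.1 q.2.1 q.2.2 :=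
    Cont.oe_loop.continuous.measurable
  have h_seq : Measurable fun q : Stmt V F P × Cont V F P => Cont.seq q.1 q.2 :=
    Cont.oe_seq.continuous.measurable
  have hd : Measurable (Measure.dirac : Config V F P → _) := Measure.measurable_dirac
  have k_halt : MeasOn (step ϑ 𝒟) _ := MeasOn.range (me_cont Cont.oe_halt) <| by
    change Measurable fun q : (V → ℝ) × Unit × Unit × ℝ =>
      Measure.dirac ((q.1, Stmt.skip, Cont.halt, q.2.2.2) : Config V F P)
    exact hd.comp (by fun_prop)
  have k_loop : MeasOn (step ϑ 𝒟) _ := MeasOn.range (me_cont Cont.oe_loop) <| by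
    classical
    have hL : MeasurableSet {q : (V → ℝ) × Unit × (Cond V × Stmt V F P × Cont V F P) × ℝ |
        q.2.2.1.1.eval q.1} :=
      Cond.measurableSet_eval.preimage (f := fun q : (V → ℝ) × Unit × (Cond V × Stmt V F P ×
        Cont V F P) × ℝ => (q.1, q.2.2.1.1)) (by fun_prop)
    refine Measurable.ite (f := fun q : (V → ℝ) × Unit × (Cond V × Stmt V F P × Cont V F P) × ℝ =>
        Measure.dirac ((q.1, q.2.2.1.2.1, Cont.loop q.2.2.1.1 q.2.2.1.2.1 q.2.2.1.2.2, q.2.2.2) :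
          Config V F P))
      (g := fun q => Measure.dirac (q.1, Stmt.skip, q.2.2.1.2.2, q.2.2.2)) hL
      (hd.comp ?_) (hd.comp ?_)
    · have := h_loop.comp
        (f := fun q : (V → ℝ) × Unit × (Cond V × Stmt V F P × Cont V F P) × ℝ => q.2.2.1)
        (by fun_prop)
      fun_prop
    · fun_prop
  have k_seq : MeasOn (step ϑ 𝒟) _ := MeasOn.range (me_cont Cont.oe_seq) <| by
    change Measurable fun q : (V → ℝ) × Unit × (Stmt V F P × Cont V F P) × ℝ =>
      Measure.dirac ((q.1, q.2.2.1.1, q.2.2.1.2, q.2.2.2) : Config V F P)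
    exact hd.comp (by fun_prop)
  have s_tick : MeasOn (step ϑ 𝒟) _ := MeasOn.range (me_stmt Stmt.oe_tick) <| by
    change Measurable fun q : (V → ℝ) × ℝ × Cont V F P × ℝ =>
      Measure.dirac ((q.1, Stmt.skip, q.2.2.1, q.2.2.2 + q.2.1) : Config V F P)
    exact hd.comp (by fun_prop)
  have s_assign : MeasOn (step ϑ 𝒟) _ := MeasOn.iUnion fun x =>
    MeasOn.range (me_stmt (Stmt.oe_assign x)) <| by
      change Measurable fun q : (V → ℝ) × Expr V × Cont V F P × ℝ =>
        Measure.dirac ((Function.update q.1 x (q.2.1.eval q.1), Stmt.skip, q.2.2.1, q.2.2.2) :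
          Config V F P)
      have h₁ : Measurable fun q : (V → ℝ) × Expr V × Cont V F P × ℝ => q.2.1.eval q.1 :=
        Expr.measurable_eval.comp (measurable_fst.prodMk (measurable_fst.comp measurable_snd))
      have h₂ : Measurable fun q : (V → ℝ) × Expr V × Cont V F P × ℝ =>
          Function.update q.1 x (q.2.1.eval q.1) :=
        measurable_update'.comp (measurable_fst.prodMk h₁)
      exact hd.comp (by fun_prop)
  have s_sample : MeasOn (step ϑ 𝒟) _ := MeasOn.iUnion fun x =>
    MeasOn.range (me_stmt (Stmt.oe_sample x)) <| by
      let κ : Kernel ((V → ℝ) × Dist P × Cont V F P × ℝ) ℝ :=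
        ⟨fun q => q.2.1.measure ϑ, (Dist.measurable_measure ϑ).comp (by fun_prop)⟩
      have : IsMarkovKernel κ := ⟨fun q => Dist.isProbabilityMeasure_measure ϑ q.2.1⟩
      change Measurable fun q : (V → ℝ) × Dist P × Cont V F P × ℝ =>
        (q.2.1.measure ϑ).bind fun r => Measure.dirac
          ((Function.update q.1 x r, Stmt.skip, q.2.2.1, q.2.2.2) : Config V F P)
      have hu : Measurable fun z : ((V → ℝ) × Dist P × Cont V F P × ℝ) × ℝ =>
          ((Function.update z.1.1 x z.2, Stmt.skip, z.1.2.2.1, z.1.2.2.2) : Config V F P) := by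
        have : Measurable fun z : ((V → ℝ) × Dist P × Cont V F P × ℝ) × ℝ =>
            Function.update z.1.1 x z.2 :=
          measurable_update'.comp ((measurable_fst.comp measurable_fst).prodMk measurable_snd)
        fun_prop
      refine Measure.measurable_of_measurable_coe _ fun B hB => ?_
      have hb (q : (V → ℝ) × Dist P × Cont V F P × ℝ) :
          ((q.2.1.measure ϑ).bind fun r => Measure.dirac
            ((Function.update q.1 x r, Stmt.skip, q.2.2.1, q.2.2.2) : Config V F P)) B =
          ∫⁻ r, B.indicator 1
            ((Function.update q.1 x r, Stmt.skip, q.2.2.1, q.2.2.2) : Config V F P) ∂(κ q) := by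
        have hm : Measurable fun r => Measure.dirac
            ((Function.update q.1 x r, Stmt.skip, q.2.2.1, q.2.2.2) : Config V F P) :=
          hd.comp (hu.comp measurable_prodMk_left)
        rw [Measure.bind_apply hB hm.aemeasurable]
        refine lintegral_congr fun r => ?_
        rw [Measure.dirac_apply' _ hB]
      simp_rw [hb]
      exact Measurable.lintegral_kernel_prod_right' ((measurable_one.indicator hB).comp hu)
  have s_call : MeasOn (step ϑ 𝒟) _ := MeasOn.iUnion fun f =>
    MeasOn.range (me_stmt (Stmt.oe_call f)) <| by
      change Measurable fun q : (V → ℝ) × Unit × Cont V F P × ℝ =>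
        Measure.dirac ((q.1, 𝒟 f, q.2.2.1, q.2.2.2) : Config V F P)
      exact hd.comp (by fun_prop)
  have s_loop : MeasOn (step ϑ 𝒟) _ := MeasOn.range (me_stmt Stmt.oe_loop) <| by
    change Measurable fun q : (V → ℝ) × (Cond V × Stmt V F P) × Cont V F P × ℝ =>
      Measure.dirac ((q.1, Stmt.skip, Cont.loop q.2.1.1 q.2.1.2 q.2.2.1, q.2.2.2) : Config V F P)
    have := h_loop.comp
      (f := fun q : (V → ℝ) × (Cond V × Stmt V F P) × Cont V F P × ℝ =>
        (q.2.1.1, q.2.1.2, q.2.2.1)) (by fun_prop)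
    exact hd.comp (measurable_fst.prodMk (measurable_const.prodMk (this.prodMk (by fun_prop))))
  have s_prob : MeasOn (step ϑ 𝒟) _ := MeasOn.range (me_stmt Stmt.oe_prob) <| by
    change Measurable fun q : (V → ℝ) × (unitInterval × Stmt V F P × Stmt V F P) ×
        Cont V F P × ℝ =>
      ENNReal.ofReal q.2.1.1 • Measure.dirac ((q.1, q.2.1.2.1, q.2.2.1, q.2.2.2) : Config V F P) +
        ENNReal.ofReal (1 - q.2.1.1) • Measure.dirac (q.1, q.2.1.2.2, q.2.2.1, q.2.2.2)
    refine Measure.measurable_of_measurable_coe _ fun B hB => ?_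
    simp only [Measure.add_apply, Measure.smul_apply, smul_eq_mul]
    refine Measurable.add (Measurable.mul ?_ ?_) (Measurable.mul ?_ ?_)
    · exact ENNReal.measurable_ofReal.comp (by fun_prop)
    · exact (Measure.measurable_coe hB).comp (hd.comp (by fun_prop))
    · exact ENNReal.measurable_ofReal.comp (by fun_prop)
    · exact (Measure.measurable_coe hB).comp (hd.comp (by fun_prop))
  have s_cond : MeasOn (step ϑ 𝒟) _ := MeasOn.range (me_stmt Stmt.oe_cond) <| by
    classical
    have hL : MeasurableSet {q : (V → ℝ) × (Cond V × Stmt V F P × Stmt V F P) × Cont V F P × ℝ |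
        q.2.1.1.eval q.1} :=
      Cond.measurableSet_eval.preimage (f := fun q : (V → ℝ) × (Cond V × Stmt V F P × Stmt V F P) ×
        Cont V F P × ℝ => (q.1, q.2.1.1)) (by fun_prop)
    exact Measurable.ite (f := fun q : (V → ℝ) × (Cond V × Stmt V F P × Stmt V F P) ×
        Cont V F P × ℝ => Measure.dirac ((q.1, q.2.1.2.1, q.2.2.1, q.2.2.2) : Config V F P))
      (g := fun q => Measure.dirac (q.1, q.2.1.2.2, q.2.2.1, q.2.2.2)) hL
      (hd.comp (by fun_prop)) (hd.comp (by fun_prop))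
  have s_seq : MeasOn (step ϑ 𝒟) _ := MeasOn.range (me_stmt Stmt.oe_seq) <| by
    change Measurable fun q : (V → ℝ) × (Stmt V F P × Stmt V F P) × Cont V F P × ℝ =>
      Measure.dirac ((q.1, q.2.1.1, Cont.seq q.2.1.2 q.2.2.1, q.2.2.2) : Config V F P)
    have := h_seq.comp
      (f := fun q : (V → ℝ) × (Stmt V F P × Stmt V F P) × Cont V F P × ℝ =>
        (q.2.1.2, q.2.2.1)) (by fun_prop)
    exact hd.comp (measurable_fst.prodMk ((measurable_fst.comp (measurable_fst.comp
      measurable_snd)).prodMk (this.prodMk (by fun_prop))))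
  refine ((k_halt.union (k_loop.union k_seq)).union (s_tick.union (s_assign.union (s_sample.union
    (s_call.union (s_loop.union (s_prob.union (s_cond.union s_seq)))))))).measurable ?_
  rintro ⟨γ, S, K, α⟩
  cases S with
  | skip => cases K <;> simp
  | _ => simp

instance [DecidableEq V] (ϑ : Kernel P ℝ) [IsMarkovKernel ϑ]
    (𝒟 : F → Stmt V F P) (σ : Config V F P) : IsProbabilityMeasure (step ϑ 𝒟 σ) := by
  obtain ⟨γ, S, K, α⟩ := σ
  cases S with
  | skip => cases K <;> simp only [step] <;> infer_instance
  | sample x D =>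
    simp only [step]
    rw [Measure.bind_dirac_eq_map _ (by fun_prop)]
    exact Measure.isProbabilityMeasure_map (by fun_prop)
  | prob p S₁ S₂ =>
    constructor
    simp only [step, Measure.add_apply, Measure.smul_apply, measure_univ, smul_eq_mul, mul_one]
    rw [← ENNReal.ofReal_add p.2.1 (sub_nonneg.2 p.2.2), add_sub_cancel, ENNReal.ofReal_one]
  | cond => simp only [step]; split_ifs <;> infer_instance
  | _ => simp only [step]; infer_instance

/-- The one-step evaluation relation as a probability kernel on configurations. -/
noncomputable def stepKernel [Finite V] [DecidableEq V] [Countable F] (ϑ : Kernel P ℝ)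
    [IsMarkovKernel ϑ] (𝒟 : F → Stmt V F P) : Kernel (Config V F P) (Config V F P) :=
  ⟨step ϑ 𝒟, step_measurable ϑ 𝒟⟩

instance [Finite V] [DecidableEq V] [Countable F] (ϑ : Kernel P ℝ) [IsMarkovKernel ϑ]
    (𝒟 : F → Stmt V F P) : IsMarkovKernel (stepKernel ϑ 𝒟) :=
  ⟨fun σ => inferInstanceAs (IsProbabilityMeasure (step ϑ 𝒟 σ))⟩

/-- The law on infinite traces of the program with function bodies `𝒟` and main statement `S`:
the Ionescu-Tulcea measure of the chain that starts at `⟨λ_. 0, S, Kstop, 0⟩` and moves by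
`stepKernel`. -/
noncomputable def traceMeasure [Finite V] [DecidableEq V] [Countable F] (ϑ : Kernel P ℝ)
    [IsMarkovKernel ϑ] (𝒟 : F → Stmt V F P) (S : Stmt V F P) : Measure (ℕ → Config V F P) :=
  Kernel.trajMeasure (X := fun _ => Config V F P)
    (Measure.dirac (fun _ => 0, S, Cont.halt, 0))
    (fun n => (stepKernel ϑ 𝒟).comap
      (fun h : (i : Finset.Iic n) → Config V F P => h ⟨n, Finset.mem_Iic.2 le_rfl⟩)
      (measurable_pi_apply _))

/-- Termination configurations `⟨_, skip, Kstop, _⟩`. -/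
def Config.IsTerminal (σ : Config V F P) : Prop := σ.2.1 = Stmt.skip ∧ σ.2.2.1 = Cont.halt

/-- The number `T(ω) = inf {n | ω n is a termination configuration}` of steps of a trace, which is
`⊤` (infinity) on traces that do not terminate. -/
noncomputable def stoppingTime (ω : ℕ → Config V F P) : ℕ∞ :=
  ⨅ (n : ℕ) (_ : Config.IsTerminal (ω n)), (n : ℕ∞)

/-- The accumulated cost `A_T(ω) = A_{T(ω)}(ω)` at termination; the value where `T(ω) = ⊤` is
immaterial, it is used only when `T` is almost surely finite. -/
noncomputable def costAtTermination (ω : ℕ → Config V F P) : ℝ :=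
  (ω (stoppingTime ω).toNat).2.2.2

end Semantics

section Logic

variable {V : Type u} {F : Type v} {P : Type w}

/-- Logical contexts `Γ`. -/
abbrev LogCtx (V : Type u) : Type u := (V → ℝ) → Prop

/-- Potential annotations `Q`. -/
abbrev Pot (V : Type u) : Type u := (V → ℝ) → ℝ

/-- A function specification `(Γ;Q, Γ';Q')`. -/
structure Spec (V : Type u) : Type u where
  pre : LogCtx V
  prePot : Pot V
  post : LogCtx V
  postPot : Pot V

/-- `Triple ϑ Adm Δ Γ Q S Γ' Q'` is the judgment `Δ ⊢ {Γ;Q} S {Γ';Q'}`, derived using only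
potential annotations that satisfy `Adm` (so every `Q` in the derivation does).
`Δ f` lists the finitely many specifications of the function `f`; it is empty for `f ∉ dom(Δ)`. -/
inductive Triple [DecidableEq V] [MeasurableSpace P] (ϑ : Kernel P ℝ) (Adm : Pot V → Prop)
    (Δ : F → List (Spec V)) :
    LogCtx V → Pot V → Stmt V F P → LogCtx V → Pot V → Prop
  | skip {Γ : LogCtx V} {Q : Pot V} (hQ : Adm Q) :
      Triple ϑ Adm Δ Γ Q .skip Γ Q
  | tick {Γ : LogCtx V} {Q Q' : Pot V} {c : ℝ} (hQ : Adm Q) (hQ' : Adm Q')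
      (h : Q = fun γ => Q' γ + c) :
      Triple ϑ Adm Δ Γ Q (.tick c) Γ Q'
  | assign {Γ Γ' : LogCtx V} {Q Q' : Pot V} {x : V} {E : Expr V} (hQ : Adm Q) (hQ' : Adm Q')
      (hΓ : Γ = fun γ => Γ' (Function.update γ x (E.eval γ)))
      (h : Q = fun γ => Q' (Function.update γ x (E.eval γ))) :
      Triple ϑ Adm Δ Γ Q (.assign x E) Γ' Q'
  | sample {Γ Γ' : LogCtx V} {Q Q' : Pot V} {x : V} {D : Dist P} (hQ : Adm Q) (hQ' : Adm Q')
      (hΓ : Γ = fun γ => ∀ r ∈ (D.measure ϑ).support, Γ' (Function.update γ x r))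
      (hint : ∀ γ, Integrable (fun r => Q' (Function.update γ x r)) (D.measure ϑ))
      (h : Q = fun γ => ∫ r, Q' (Function.update γ x r) ∂(D.measure ϑ)) :
      Triple ϑ Adm Δ Γ Q (.sample x D) Γ' Q'
  | loop {Γ : LogCtx V} {Q : Pot V} {L : Cond V} {S : Stmt V F P}
      (h : Triple ϑ Adm Δ (fun γ => Γ γ ∧ L.eval γ) Q S Γ Q) :
      Triple ϑ Adm Δ Γ Q (.loop L S) (fun γ => Γ γ ∧ ¬ L.eval γ) Q
  | cond {Γ Γ' : LogCtx V} {Q Q' : Pot V} {L : Cond V} {S₁ S₂ : Stmt V F P}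
      (h₁ : Triple ϑ Adm Δ (fun γ => Γ γ ∧ L.eval γ) Q S₁ Γ' Q')
      (h₂ : Triple ϑ Adm Δ (fun γ => Γ γ ∧ ¬ L.eval γ) Q S₂ Γ' Q') :
      Triple ϑ Adm Δ Γ Q (.cond L S₁ S₂) Γ' Q'
  | seq {Γ Γ' Γ'' : LogCtx V} {Q Q' Q'' : Pot V} {S₁ S₂ : Stmt V F P}
      (h₁ : Triple ϑ Adm Δ Γ Q S₁ Γ' Q') (h₂ : Triple ϑ Adm Δ Γ' Q' S₂ Γ'' Q'') :
      Triple ϑ Adm Δ Γ Q (.seq S₁ S₂) Γ'' Q''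
  | call {f : F} {s : Spec V} {c : ℝ} (hs : s ∈ Δ f)
      (hQ : Adm fun γ => s.prePot γ + c) (hQ' : Adm fun γ => s.postPot γ + c) :
      Triple ϑ Adm Δ s.pre (fun γ => s.prePot γ + c) (.call f)
        s.post (fun γ => s.postPot γ + c)
  | prob {Γ Γ' : LogCtx V} {Q Q₁ Q₂ Q' : Pot V} {p : unitInterval} {S₁ S₂ : Stmt V F P}
      (h₁ : Triple ϑ Adm Δ Γ Q₁ S₁ Γ' Q') (h₂ : Triple ϑ Adm Δ Γ Q₂ S₂ Γ' Q')
      (hQ : Adm Q) (h : Q = fun γ => (p : ℝ) * Q₁ γ + (1 - (p : ℝ)) * Q₂ γ) :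
      Triple ϑ Adm Δ Γ Q (.prob p S₁ S₂) Γ' Q'
  | weaken {Γ Γ₀ Γ₀' Γ' : LogCtx V} {Q Q₀ Q₀' Q' : Pot V} {S : Stmt V F P}
      (h : Triple ϑ Adm Δ Γ₀ Q₀ S Γ₀' Q₀')
      (hpre : ∀ γ, Γ γ → Γ₀ γ) (hpost : ∀ γ, Γ₀' γ → Γ' γ)
      (hQ : Adm Q) (hQ' : Adm Q')
      (hpreQ : ∀ γ, Γ γ → Q₀ γ ≤ Q γ) (hpostQ : ∀ γ, Γ₀' γ → Q' γ ≤ Q₀' γ) :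
      Triple ϑ Adm Δ Γ Q S Γ' Q'

/-- The judgment `⊢ Δ` for function bodies `𝒟`: every specification in `Δ` is derivable for the
body of its function. -/
def ValidCtx [DecidableEq V] [MeasurableSpace P] (ϑ : Kernel P ℝ) (Adm : Pot V → Prop)
    (𝒟 : F → Stmt V F P) (Δ : F → List (Spec V)) : Prop :=
  ∀ f, ∀ s ∈ Δ f, Triple ϑ Adm Δ s.pre s.prePot (𝒟 f) s.post s.postPot

/-- `Q` is a polynomial in the program variables, of total degree at most `d`. -/
def IsPolynomialPot (d : ℕ) (Q : Pot V) : Prop :=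
  ∃ p : MvPolynomial V ℝ, p.totalDegree ≤ d ∧ ∀ γ, Q γ = MvPolynomial.eval γ p

end Logic

end Appl

/-! The potential pays for the remaining cost: along a derivation, accumulated cost plus current
potential does not increase in expectation in one step. Costs and potentials may be negative, so
monotone convergence is unavailable, and the passage from a finite horizon to time `T` needs a
dominating function.

Run the program for exactly `n` steps. If it has terminated, pay out the accumulated cost; otherwise
pay out the cost minus a quantity that dominates the absolute value of whatever potential is still
pending. This is `payoff`. A run that is cut off then never receives more than its cost plus pending
potential, so an induction on the number of remaining steps, with an inner induction on the
derivation, shows that the expected payoff after `n` steps is at most the initial potential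
(`Triple.expBound`). The induction carries, as a hypothesis on the continuation, the same bound for
all shorter horizons. No annotation has to be attached to the reachable configurations.

The pending potential has two components. The annotations in the given derivations are finitely many
polynomials of degree at most `d`, so a single `C` bounds them all by `C (1 + ‖γ‖) ^ d`. In
addition, the call rule adds a frame constant, and nested calls accumulate these. Both the
specification's precondition potential and its shift by the frame constant `c` are bounded by `C` at
the zero valuation, so `|c| ≤ 2 C`. Within `n` steps there are at most `n` calls, and the allowance
`A = 2 C n` covers all frames.

Finally let `n` tend to infinity. Valuations grow at most linearly by the bounded-update hypothesis,
and costs grow at most linearly because the program text contains finitely many ticks. Before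
termination the time is below `T`, and afterwards the cost is frozen; hence all payoffs are
dominated by a constant plus a multiple of `T ^ d` (`abs_payoff_le`), which is integrable. On a
terminating trace the payoff is eventually the cost at termination, and dominated convergence
concludes. -/

namespace Appl

/-! ### Conditional bounds on finite-horizon expectations of a Markov chain -/

section ExpBound

variable {X : Type*} [MeasurableSpace X]

/-- The expectation of `g` after `n` steps of the chain `κ` from `σ` is at most `b`, provided it
exists. -/
def ExpBound (κ : Kernel X X) (g : X → ℝ) (n : ℕ) (σ : X) (b : ℝ) : Prop :=
  Integrable g ((κ ^ n) σ) → ∫ x, g x ∂((κ ^ n) σ) ≤ b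

variable {κ : Kernel X X} {g : X → ℝ} {n : ℕ} {σ σ' : X} {b b' : ℝ}

theorem ExpBound.mono (h : ExpBound κ g n σ b) (hb : b ≤ b') : ExpBound κ g n σ b' :=
  fun hi => (h hi).trans hb

theorem ExpBound.zero (hg : Measurable g) (h : g σ ≤ b) : ExpBound κ g 0 σ b := fun _ => by
  have : ((κ ^ 0) σ : Measure X) = Measure.dirac σ := by
    rw [pow_zero]; exact Kernel.id_apply σ
  rwa [this, integral_dirac' _ _ hg.stronglyMeasurable]

/-- Splits off the first step of the chain. Integrability under the `n + 1`-step law passes, by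
Fubini for kernels, to almost every successor and to the inner integral, so it comes for free. This
is why `ExpBound` is conditional: integrability has to be checked only at the initial configuration.
-/
theorem ExpBound.succ (h : Integrable (fun x => ∫ y, g y ∂((κ ^ n) x)) (κ σ) →
    (∀ᵐ x ∂κ σ, Integrable g ((κ ^ n) x)) → ∫ x, ∫ y, g y ∂((κ ^ n) x) ∂(κ σ) ≤ b) :
    ExpBound κ g (n + 1) σ b := fun hi => by
  have hs : κ ^ (n + 1) = (κ ^ n) ∘ₖ κ := pow_succ κ n
  rw [hs] at hi ⊢
  rw [Kernel.integral_comp hi]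
  exact h hi.integral_comp hi.ae_of_comp

theorem ExpBound.succ_dirac (hσ : κ σ = Measure.dirac σ') (h : ExpBound κ g n σ' b) :
    ExpBound κ g (n + 1) σ b := by
  have hs : (κ ^ (n + 1)) σ = (κ ^ n) σ' := by
    have : κ ^ (n + 1) = (κ ^ n) ∘ₖ κ := pow_succ κ n
    rw [this, Kernel.comp_apply, hσ, Measure.dirac_bind (Kernel.measurable _)]
  simpa only [ExpBound, hs] using h

end ExpBound

/-! ### One growth constant for all annotations of a derivation -/

section Growth

variable {V F P : Type*}

/-- `Q` grows at most like `C (1 + ‖γ‖) ^ d`. -/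
def PolyBdd [Fintype V] (d : ℕ) (C : ℝ) (Q : Pot V) : Prop :=
  ∀ γ, |Q γ| ≤ C * (1 + ‖γ‖) ^ d

/-- Each variable is at most `1 + ‖γ‖`, and this base is at least `1`, so every monomial of degree
at most `d` is at most `(1 + ‖γ‖) ^ d`; the sum of the absolute coefficients serves as constant. The
form "for all large `C`" lets finitely many such bounds be combined. -/
theorem IsPolynomialPot.eventually_polyBdd [Fintype V] {d : ℕ} {Q : Pot V}
    (h : IsPolynomialPot d Q) : ∀ᶠ C in Filter.atTop, PolyBdd d C Q := by
  obtain ⟨p, hp, hQ⟩ := h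
  filter_upwards [Filter.eventually_ge_atTop (∑ m ∈ p.support, |p.coeff m|)] with C hC γ
  have h1 : (1 : ℝ) ≤ 1 + ‖γ‖ := le_add_of_nonneg_right (norm_nonneg γ)
  calc |Q γ| = |∑ m ∈ p.support, p.coeff m * ∏ i, γ i ^ m i| := by
        rw [hQ, MvPolynomial.eval_eq']
    _ ≤ ∑ m ∈ p.support, |p.coeff m * ∏ i, γ i ^ m i| := Finset.abs_sum_le_sum_abs _ _
    _ ≤ ∑ m ∈ p.support, |p.coeff m| * (1 + ‖γ‖) ^ d := by
        refine Finset.sum_le_sum fun m hm => ?_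
        rw [abs_mul, Finset.abs_prod]
        refine mul_le_mul_of_nonneg_left ?_ (abs_nonneg _)
        calc ∏ i, |γ i ^ m i| ≤ ∏ i, (1 + ‖γ‖) ^ m i := by
              refine Finset.prod_le_prod (fun _ _ => abs_nonneg _) fun i _ => ?_
              rw [abs_pow]
              refine pow_le_pow_left₀ (abs_nonneg _) ?_ _
              exact (norm_le_pi_norm γ i).trans (le_add_of_nonneg_left zero_le_one)
          _ = (1 + ‖γ‖) ^ ∑ i, m i := Finset.prod_pow_eq_pow_sum _ _ _
          _ ≤ (1 + ‖γ‖) ^ d := by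
              refine pow_le_pow_right₀ h1 (le_trans ?_ ((MvPolynomial.le_totalDegree hm).trans hp))
              rw [Finsupp.sum_fintype _ _ fun _ => rfl]
    _ = (∑ m ∈ p.support, |p.coeff m|) * (1 + ‖γ‖) ^ d := (Finset.sum_mul _ _ _).symm
    _ ≤ C * (1 + ‖γ‖) ^ d := mul_le_mul_of_nonneg_right hC (by positivity)

variable [DecidableEq V] [MeasurableSpace P] {ϑ : Kernel P ℝ} {Δ : F → List (Spec V)}
  {Γ Γ' : LogCtx V} {Q Q' : Pot V} {S : Stmt V F P}

/-- A derivation is a finitely branching finite tree, so finitely many eventual conditions hold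
simultaneously. With `Adm' C = PolyBdd d C` this produces a single constant valid throughout the
derivation. -/
theorem Triple.eventually {ι : Type*} {l : Filter ι} {Adm : Pot V → Prop} {Adm' : ι → Pot V → Prop}
    (hA : ∀ Q, Adm Q → ∀ᶠ i in l, Adm' i Q) (h : Triple ϑ Adm Δ Γ Q S Γ' Q') :
    ∀ᶠ i in l, Triple ϑ (Adm' i) Δ Γ Q S Γ' Q' := by
  induction h with
  | skip hQ => filter_upwards [hA _ hQ] with i h using .skip h
  | tick hQ hQ' h => filter_upwards [hA _ hQ, hA _ hQ'] with i h₁ h₂ using .tick h₁ h₂ h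
  | assign hQ hQ' hΓ h =>
    filter_upwards [hA _ hQ, hA _ hQ'] with i h₁ h₂ using .assign h₁ h₂ hΓ h
  | sample hQ hQ' hΓ hint h =>
    filter_upwards [hA _ hQ, hA _ hQ'] with i h₁ h₂ using .sample h₁ h₂ hΓ hint h
  | loop _ ih => filter_upwards [ih] with i h using .loop h
  | cond _ _ ih₁ ih₂ => filter_upwards [ih₁, ih₂] with i h₁ h₂ using .cond h₁ h₂
  | seq _ _ ih₁ ih₂ => filter_upwards [ih₁, ih₂] with i h₁ h₂ using .seq h₁ h₂
  | call hs hQ hQ' => filter_upwards [hA _ hQ, hA _ hQ'] with i h₁ h₂ using .call hs h₁ h₂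
  | prob _ _ hQ h ih₁ ih₂ =>
    filter_upwards [ih₁, ih₂, hA _ hQ] with i h₁ h₂ h₃ using .prob h₁ h₂ h₃ h
  | weaken _ hpre hpost hQ hQ' hpreQ hpostQ ih =>
    filter_upwards [ih, hA _ hQ, hA _ hQ'] with i h h₁ h₂
      using .weaken h hpre hpost h₁ h₂ hpreQ hpostQ

theorem ValidCtx.eventually [Finite F] {ι : Type*} {l : Filter ι} {Adm : Pot V → Prop}
    {Adm' : ι → Pot V → Prop} {𝒟 : F → Stmt V F P}
    (hA : ∀ Q, Adm Q → ∀ᶠ i in l, Adm' i Q) (h : ValidCtx ϑ Adm 𝒟 Δ) :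
    ∀ᶠ i in l, ValidCtx ϑ (Adm' i) 𝒟 Δ :=
  Filter.eventually_all.2 fun f => (Filter.eventually_all_finite (List.finite_toSet (Δ f))).2
    fun s hs => (h f s hs).eventually hA

theorem Triple.adm_pre {Adm : Pot V → Prop} (h : Triple ϑ Adm Δ Γ Q S Γ' Q') : Adm Q := by
  induction h <;> assumption

theorem Triple.adm_post {Adm : Pot V → Prop} (h : Triple ϑ Adm Δ Γ Q S Γ' Q') : Adm Q' := by
  induction h with
  | loop h => exact h.adm_pre
  | _ => assumption

end Growth

/-! ### The payoff at a finite horizon and soundness of the rules for it -/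

section Payoff

variable {V F P : Type*}

open Classical in
/-- The accumulated cost, lowered at configurations that have not terminated by a bound for the
remaining potential. -/
noncomputable def payoff [Fintype V] (d : ℕ) (C A : ℝ) (σ : Config V F P) : ℝ :=
  if σ.IsTerminal then σ.2.2.2 else σ.2.2.2 - (C * (1 + ‖σ.1‖) ^ d + A)

variable [EMetricSpace P] [SecondCountableTopology P]

theorem Config.measurableSet_isTerminal [Countable V] [Countable F] :
    MeasurableSet {σ : Config V F P | σ.IsTerminal} := by
  have h₁ : MeasurableSet {σ : Config V F P | σ.2.1 = Stmt.skip} :=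
    (measurableSet_singleton Stmt.skip).preimage (by fun_prop)
  have h₂ : MeasurableSet {σ : Config V F P | σ.2.2.1 = Cont.halt} :=
    (measurableSet_singleton Cont.halt).preimage (by fun_prop)
  exact h₁.inter h₂

variable [Fintype V] [Countable F] {d : ℕ} {C A : ℝ}

theorem measurable_payoff : Measurable (payoff d C A : Config V F P → ℝ) := by
  classical
  exact Measurable.ite Config.measurableSet_isTerminal (by fun_prop) (by fun_prop)

variable [DecidableEq V] [MeasurableSpace P] [BorelSpace P] {ϑ : Kernel P ℝ} [IsMarkovKernel ϑ]
  {𝒟 : F → Stmt V F P} {Δ : F → List (Spec V)}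

/-- Time has run out before termination: the deduction in `payoff` dominates both the annotation and
the frame constant `c`, whatever their signs. -/
theorem expBound_zero_of_polyBdd {Q : Pot V} (hQ : PolyBdd d C Q) {c : ℝ} (hc : |c| ≤ A)
    {γ : V → ℝ} {S : Stmt V F P} {K : Cont V F P} {α : ℝ}
    (hn : ¬ Config.IsTerminal (γ, S, K, α)) :
    ExpBound (stepKernel ϑ 𝒟) (payoff d C A) 0 (γ, S, K, α) (Q γ + c + α) := by
  refine .zero measurable_payoff ?_
  rw [payoff, if_neg hn]
  have h₁ := neg_le_of_abs_le (hQ γ)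
  have h₂ := neg_le_of_abs_le hc
  dsimp only at h₁ ⊢
  linarith

theorem expBound_halt (n : ℕ) (γ : V → ℝ) (α : ℝ) :
    ExpBound (stepKernel ϑ 𝒟) (payoff d C A) n (γ, .skip, .halt, α) α := by
  induction n with
  | zero =>
    refine .zero measurable_payoff ?_
    rw [payoff, if_pos ⟨rfl, rfl⟩]
  | succ n ih => exact .succ_dirac rfl ih

/-- Each test of the guard consumes a step, so the loop invariant is proved by induction on the
remaining time: the body is entered with less time, and its continuation is the loop head itself,
for which the bound is already known. -/
theorem expBound_loop {n : ℕ} {Γ : LogCtx V} {Q : Pot V} {c : ℝ} {L : Cond V}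
    {S : Stmt V F P} {K : Cont V F P} (hQ : PolyBdd d C Q) (hc : |c| ≤ A)
    (hS : ∀ m < n, (∀ k ≤ m, ∀ γ α, Γ γ → ExpBound (stepKernel ϑ 𝒟) (payoff d C A) k
      (γ, .skip, .loop L S K, α) (Q γ + c + α)) →
      ∀ γ α, Γ γ → L.eval γ → ExpBound (stepKernel ϑ 𝒟) (payoff d C A) m
        (γ, S, .loop L S K, α) (Q γ + c + α))
    (hK : ∀ m < n, ∀ γ α, Γ γ → ¬ L.eval γ →
      ExpBound (stepKernel ϑ 𝒟) (payoff d C A) m (γ, .skip, K, α) (Q γ + c + α)) :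
    ∀ m ≤ n, ∀ γ α, Γ γ → ExpBound (stepKernel ϑ 𝒟) (payoff d C A) m
      (γ, .skip, .loop L S K, α) (Q γ + c + α) := by
  intro m
  induction m using Nat.strong_induction_on with
  | _ m ih =>
  intro hm γ α hγ
  rcases m with _ | m
  · exact expBound_zero_of_polyBdd hQ hc fun h => nomatch h.2
  by_cases hL : L.eval γ
  · exact .succ_dirac (if_pos hL)
      (hS m hm (fun k hk => ih k (Nat.lt_succ_of_le hk) (by omega)) γ α hγ hL)
  · exact .succ_dirac (if_neg hL) (hK m hm γ α hγ hL)

theorem expBound_sample {n : ℕ} {γ : V → ℝ} {x : V} {D : Dist P} {K : Cont V F P} {α c : ℝ}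
    {Q : Pot V} {g : Config V F P → ℝ}
    (hint : Integrable (fun r => Q (Function.update γ x r)) (D.measure ϑ))
    (h : ∀ r ∈ (D.measure ϑ).support, ExpBound (stepKernel ϑ 𝒟) g n
      (Function.update γ x r, .skip, K, α) (Q (Function.update γ x r) + c + α)) :
    ExpBound (stepKernel ϑ 𝒟) g (n + 1) (γ, .sample x D, K, α)
      (∫ r, Q (Function.update γ x r) ∂(D.measure ϑ) + c + α) := by
  have hm : Measurable fun r => ((Function.update γ x r, .skip, K, α) : Config V F P) := by
    fun_prop
  have hs : stepKernel ϑ 𝒟 (γ, .sample x D, K, α) = (D.measure ϑ).map fun r =>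
      ((Function.update γ x r, .skip, K, α) : Config V F P) :=
    Measure.bind_dirac_eq_map _ hm
  refine .succ fun hi hae => ?_
  rw [hs] at hi hae ⊢
  rw [integral_map hm.aemeasurable hi.1]
  have hi' := hi.comp_measurable hm
  calc _ ≤ ∫ r, (Q (Function.update γ x r) + c + α) ∂(D.measure ϑ) := by
        refine integral_mono_ae hi' ((hint.add (integrable_const c)).add (integrable_const α)) ?_
        -- The premise concerns only outcomes in the support of the distribution; in `ℝ` the support
        -- has full measure.
        filter_upwards [ae_of_ae_map hm.aemeasurable hae, Measure.support_mem_ae] with r h₁ h₂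
        exact h r h₂ h₁
    _ = _ := by
        simp only [add_assoc]
        rw [integral_add hint (integrable_const (c + α))]
        simp

theorem expBound_prob {n : ℕ} {γ : V → ℝ} {p : unitInterval} {S₁ S₂ : Stmt V F P}
    {K : Cont V F P} {α b₁ b₂ : ℝ} {g : Config V F P → ℝ} (hg : Measurable g)
    (h₁ : ExpBound (stepKernel ϑ 𝒟) g n (γ, S₁, K, α) b₁)
    (h₂ : ExpBound (stepKernel ϑ 𝒟) g n (γ, S₂, K, α) b₂) :
    ExpBound (stepKernel ϑ 𝒟) g (n + 1) (γ, .prob p S₁ S₂, K, α)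
      ((p : ℝ) * b₁ + (1 - (p : ℝ)) * b₂) := by
  have hs : stepKernel ϑ 𝒟 (γ, .prob p S₁ S₂, K, α) =
      ENNReal.ofReal p • Measure.dirac (γ, S₁, K, α) +
        ENNReal.ofReal (1 - p) • Measure.dirac (γ, S₂, K, α) := rfl
  have hp₀ : (0 : ℝ) ≤ p := p.2.1
  have hp₁ : (0 : ℝ) ≤ 1 - p := sub_nonneg.2 p.2.2
  have hG : StronglyMeasurable fun x => ∫ y, g y ∂((stepKernel ϑ 𝒟 ^ n) x) :=
    hg.stronglyMeasurable.integral_kernel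
  have key {q b : ℝ} {σ : Config V F P} (hq : 0 ≤ q) (h : ExpBound (stepKernel ϑ 𝒟) g n σ b)
      (hae : ∀ᵐ x ∂(ENNReal.ofReal q • Measure.dirac σ), Integrable g ((stepKernel ϑ 𝒟 ^ n) x)) :
      q * ∫ y, g y ∂((stepKernel ϑ 𝒟 ^ n) σ) ≤ q * b := by
    -- A branch of probability zero inherits no integrability, so its conditional bound is unusable;
    -- its contribution vanishes anyway.
    rcases hq.eq_or_lt with rfl | hq
    · simp
    · rw [Measure.ae_ennreal_smul_measure_iff (ENNReal.ofReal_pos.2 hq).ne', ae_dirac_eq] at hae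
      exact mul_le_mul_of_nonneg_left (h hae) hq.le
  refine .succ fun hi hae => ?_
  rw [hs] at hi hae ⊢
  rw [ae_add_measure_iff] at hae
  rw [integral_add_measure hi.left_of_add_measure hi.right_of_add_measure, integral_smul_measure,
    integral_smul_measure, integral_dirac' _ _ hG, integral_dirac' _ _ hG,
    ENNReal.toReal_ofReal hp₀, ENNReal.toReal_ofReal hp₁]
  exact add_le_add (key hp₀ h₁ hae.1) (key hp₁ h₂ hae.2)

/-- Soundness in continuation-passing form: if `K` turns the postcondition into a payoff bound at
every horizon up to `n`, then `S` followed by `K` turns the precondition into one at horizon `n`.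
The condition `|c| + 2 * C * n ≤ A` reserves `2 * C` for each step that may still be a call. The
outer induction is on `n`, which makes recursive calls and loops well founded; the inner induction
on the derivation is needed for `weaken`, which consumes no step. -/
theorem Triple.expBound (hΔ : ValidCtx ϑ (PolyBdd d C) 𝒟 Δ) (hC : 0 ≤ C) (n : ℕ) :
    ∀ {Γ Γ' : LogCtx V} {Q Q' : Pot V} {S : Stmt V F P},
      Triple ϑ (PolyBdd d C) Δ Γ Q S Γ' Q' → ∀ (K : Cont V F P) (c : ℝ), |c| + 2 * C * n ≤ A →
      (∀ m ≤ n, ∀ γ α, Γ' γ →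
        ExpBound (stepKernel ϑ 𝒟) (payoff d C A) m (γ, .skip, K, α) (Q' γ + c + α)) →
      ∀ γ α, Γ γ →
        ExpBound (stepKernel ϑ 𝒟) (payoff d C A) n (γ, S, K, α) (Q γ + c + α) := by
  induction n using Nat.strong_induction_on with
  | _ n IH =>
  intro Γ Γ' Q Q' S h K c hc hK γ α hγ
  have hcA : |c| ≤ A := le_trans (le_add_of_nonneg_right (by positivity)) hc
  have hcm {m : ℕ} (hm : m < n) : |c| + 2 * C * m ≤ A := by
    refine le_trans ?_ hc
    gcongr
  -- With no time left and `S` not `skip`, the configuration is not terminal and the cut-off bound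
  -- applies. For `skip` the configuration may be terminal, and the hypothesis on `K` is used
  -- instead.
  by_cases hS : S = .skip ∨ n ≠ 0
  swap
  · obtain ⟨hne, rfl⟩ : S ≠ .skip ∧ n = 0 := by simpa using hS
    exact expBound_zero_of_polyBdd h.adm_pre hcA fun h => hne h.1
  induction h generalizing K c γ α with
  | skip hQ => exact hK n le_rfl γ α hγ
  | weaken h hpre hpost hQ hQ' hpreQ hpostQ ih =>
    refine (ih K c hc (fun m hm γ α hγ => ?_) γ α (hpre γ hγ) hcA hcm hS).mono ?_
    · exact (hK m hm γ α (hpost γ hγ)).mono (by linarith [hpostQ γ hγ])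
    · linarith [hpreQ γ hγ]
  | tick hQ hQ' h =>
    obtain ⟨n, rfl⟩ := Nat.exists_eq_succ_of_ne_zero (by simpa using hS)
    subst h
    exact .succ_dirac rfl ((hK n n.le_succ γ _ hγ).mono (by linarith))
  | assign hQ hQ' hΓ h =>
    obtain ⟨n, rfl⟩ := Nat.exists_eq_succ_of_ne_zero (by simpa using hS)
    subst h hΓ
    exact .succ_dirac rfl (hK n n.le_succ _ _ hγ)
  | sample hQ hQ' hΓ hint h =>
    obtain ⟨n, rfl⟩ := Nat.exists_eq_succ_of_ne_zero (by simpa using hS)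
    subst h hΓ
    exact expBound_sample (hint γ) fun r hr => hK n n.le_succ _ _ (hγ r hr)
  | loop h =>
    obtain ⟨n, rfl⟩ := Nat.exists_eq_succ_of_ne_zero (by simpa using hS)
    -- One step installs the loop continuation. The outer induction hypothesis then handles the
    -- body, taking the bound at the loop head as its hypothesis on the continuation.
    refine .succ_dirac rfl (expBound_loop (n := n) h.adm_pre hcA ?_ ?_ n le_rfl γ α hγ)
    · intro m hm hk γ α hγ hL
      exact IH m (by omega) h _ c (hcm (by omega)) hk γ α ⟨hγ, hL⟩
    · intro m hm γ α hγ hL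
      exact hK m (by omega) γ α ⟨hγ, hL⟩
  | cond h₁ h₂ =>
    obtain ⟨n, rfl⟩ := Nat.exists_eq_succ_of_ne_zero (by simpa using hS)
    rename_i L _ _ _ _
    by_cases hL : L.eval γ
    · exact .succ_dirac (if_pos hL) (IH n n.lt_succ_self h₁ K c (hcm n.lt_succ_self)
        (fun m hm => hK m (by omega)) γ α ⟨hγ, hL⟩)
    · exact .succ_dirac (if_neg hL) (IH n n.lt_succ_self h₂ K c (hcm n.lt_succ_self)
        (fun m hm => hK m (by omega)) γ α ⟨hγ, hL⟩)
  | seq h₁ h₂ =>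
    obtain ⟨n, rfl⟩ := Nat.exists_eq_succ_of_ne_zero (by simpa using hS)
    refine .succ_dirac rfl (IH n n.lt_succ_self h₁ _ c (hcm n.lt_succ_self) ?_ γ α hγ)
    -- The continuation `Kseq` spends one step on resuming `S₂`. At horizon `0` it is cut off before
    -- doing so, and the intermediate annotation is covered by the deduction.
    rintro (_ | m) hm γ α hγ
    · exact expBound_zero_of_polyBdd h₁.adm_post hcA fun h => nomatch h.2
    · exact .succ_dirac rfl (IH m (by omega) h₂ K c (hcm (by omega))
        (fun k hk => hK k (by omega)) γ α hγ)
  | call hs hQ hQ' =>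
    obtain ⟨n, rfl⟩ := Nat.exists_eq_succ_of_ne_zero (by simpa using hS)
    rename_i f s c'
    -- At the zero valuation the growth bound is just `C`, both for the specification's precondition
    -- potential and for its shift by `c'`; their difference is the frame constant.
    have hb : |c'| ≤ 2 * C := by
      have h₁ := hQ 0
      have h₂ := (hΔ f s hs).adm_pre 0
      simp only [norm_zero, add_zero, one_pow, mul_one, abs_le] at h₁ h₂ ⊢
      constructor <;> linarith
    -- The step spent on the call releases `2 * C` of the allowance, which pays for the new frame.
    have hc' : |c' + c| + 2 * C * n ≤ A := by
      push_cast at hc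
      linarith [abs_add_le c' c]
    refine .succ_dirac rfl ((IH n n.lt_succ_self (hΔ f s hs) K (c' + c) hc' ?_ γ α hγ).mono
      (by linarith))
    exact fun m hm γ α hγ => (hK m (by omega) γ α hγ).mono (by linarith)
  | prob h₁ h₂ hQ h =>
    obtain ⟨n, rfl⟩ := Nat.exists_eq_succ_of_ne_zero (by simpa using hS)
    subst h
    refine (expBound_prob measurable_payoff
      (IH n n.lt_succ_self h₁ K c (hcm n.lt_succ_self) (fun m hm => hK m (by omega)) γ α hγ)
      (IH n n.lt_succ_self h₂ K c (hcm n.lt_succ_self)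
        (fun m hm => hK m (by omega)) γ α hγ)).mono (le_of_eq ?_)
    ring

end Payoff

/-! ### Markov property of the trace measure and almost sure growth of traces -/

section Trace

variable {V F P : Type*}

/-- All tick amounts in a statement are bounded by `M` in absolute value. -/
def Stmt.TickBdd (M : ℝ) : Stmt V F P → Prop
  | .tick c => |c| ≤ M
  | .loop _ S => S.TickBdd M
  | .prob _ S₁ S₂ => S₁.TickBdd M ∧ S₂.TickBdd M
  | .cond _ S₁ S₂ => S₁.TickBdd M ∧ S₂.TickBdd M
  | .seq S₁ S₂ => S₁.TickBdd M ∧ S₂.TickBdd M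
  | _ => True

/-- All tick amounts in a continuation are bounded by `M` in absolute value. -/
def Cont.TickBdd (M : ℝ) : Cont V F P → Prop
  | .halt => True
  | .loop _ S K => S.TickBdd M ∧ K.TickBdd M
  | .seq S K => S.TickBdd M ∧ K.TickBdd M

theorem Stmt.eventually_tickBdd (S : Stmt V F P) : ∀ᶠ M in Filter.atTop, S.TickBdd M := by
  induction S with
  | tick c => exact Filter.eventually_ge_atTop |c|
  | loop _ _ ih => exact ih
  | prob _ _ _ h₁ h₂ => exact h₁.and h₂
  | cond _ _ _ h₁ h₂ => exact h₁.and h₂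
  | seq _ _ h₁ h₂ => exact h₁.and h₂
  | _ => exact Filter.Eventually.of_forall fun _ => trivial

variable [EMetricSpace P] [SecondCountableTopology P] [MeasurableSpace P] [BorelSpace P]
  [Finite V] [DecidableEq V] [Countable F] {ϑ : Kernel P ℝ} [IsMarkovKernel ϑ]
  {𝒟 : F → Stmt V F P} {M : ℝ}

/-- Execution only rearranges subterms of the current statement, of the continuation and of the
function bodies, so a bound on the tick amounts is invariant, and one step changes the cost by at
most that bound. -/
theorem ae_step_tickBdd (hM : 0 ≤ M) (h𝒟 : ∀ f, (𝒟 f).TickBdd M) {σ : Config V F P}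
    (hS : σ.2.1.TickBdd M) (hK : σ.2.2.1.TickBdd M) :
    ∀ᵐ σ' ∂(step ϑ 𝒟 σ), (σ'.2.1.TickBdd M ∧ σ'.2.2.1.TickBdd M) ∧
      |σ'.2.2.2 - σ.2.2.2| ≤ M := by
  obtain ⟨γ, S, K, α⟩ := σ
  cases S with
  | skip =>
    cases K with
    | halt => simp_all [step, Stmt.TickBdd, Cont.TickBdd, ae_dirac_eq]
    | loop L S K =>
      by_cases hL : L.eval γ <;> simp_all [step, Stmt.TickBdd, Cont.TickBdd, ae_dirac_eq]
    | seq S K => simp_all [step, Stmt.TickBdd, Cont.TickBdd, ae_dirac_eq]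
  | sample x D =>
    have hm : Measurable fun r => ((Function.update γ x r, .skip, K, α) : Config V F P) := by
      fun_prop
    have hs : step ϑ 𝒟 (γ, .sample x D, K, α) = (D.measure ϑ).map fun r =>
        ((Function.update γ x r, .skip, K, α) : Config V F P) :=
      Measure.bind_dirac_eq_map _ hm
    rw [hs]
    have hmeas : MeasurableSet {σ : Config V F P | σ.2 = (.skip, K, α)} :=
      (measurableSet_singleton _).preimage measurable_snd
    have : ∀ᵐ σ' ∂(D.measure ϑ).map fun r =>
        ((Function.update γ x r, .skip, K, α) : Config V F P), σ'.2 = (.skip, K, α) :=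
      (ae_map_iff hm.aemeasurable hmeas).2 (Filter.Eventually.of_forall fun _ => rfl)
    filter_upwards [this] with σ' h
    rw [h]
    simpa [Stmt.TickBdd, hM] using hK
  | prob p S₁ S₂ =>
    simp only [step, ae_add_measure_iff]
    constructor <;> refine Measure.ae_smul_measure ?_ _ <;>
      simp_all [Stmt.TickBdd, ae_dirac_eq]
  | cond L S₁ S₂ =>
    by_cases hL : L.eval γ <;> simp_all [step, Stmt.TickBdd, ae_dirac_eq]
  | _ => simp_all [step, Stmt.TickBdd, Cont.TickBdd, ae_dirac_eq]

theorem ae_pow_tickBdd (hM : 0 ≤ M) (h𝒟 : ∀ f, (𝒟 f).TickBdd M) (n : ℕ) {σ : Config V F P}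
    (hS : σ.2.1.TickBdd M) (hK : σ.2.2.1.TickBdd M) :
    ∀ᵐ σ' ∂((stepKernel ϑ 𝒟 ^ n) σ), |σ'.2.2.2 - σ.2.2.2| ≤ M * n := by
  induction n generalizing σ with
  | zero =>
    have : ((stepKernel ϑ 𝒟 ^ 0) σ : Measure _) = Measure.dirac σ := by
      rw [pow_zero]; exact Kernel.id_apply σ
    rw [this, ae_dirac_eq]
    simp
  | succ n ih =>
    have : stepKernel ϑ 𝒟 ^ (n + 1) = (stepKernel ϑ 𝒟 ^ n) ∘ₖ stepKernel ϑ 𝒟 := pow_succ _ n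
    rw [this, Kernel.comp_apply,
      Measure.ae_comp_iff (measurableSet_le (by fun_prop) (by fun_prop))]
    filter_upwards [ae_step_tickBdd hM h𝒟 hS hK] with τ hτ
    filter_upwards [ih hτ.1.1 hτ.1.2] with σ' h
    push_cast
    linarith [abs_sub_le σ'.2.2.2 τ.2.2.2 σ.2.2.2, hτ.2]

instance (S : Stmt V F P) : IsProbabilityMeasure (traceMeasure ϑ 𝒟 S) := by
  unfold traceMeasure; infer_instance

/-- The Ionescu-Tulcea construction describes the next state given the whole history. Since the
transition depends on the last coordinate only, the history can be forgotten. -/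
theorem map_traceMeasure_pair (S : Stmt V F P) (n : ℕ) :
    (traceMeasure ϑ 𝒟 S).map (fun ω => (ω n, ω (n + 1))) =
      (traceMeasure ϑ 𝒟 S).map (fun ω => ω n) ⊗ₘ stepKernel ϑ 𝒟 := by
  let last : ((i : Finset.Iic n) → Config V F P) → Config V F P :=
    fun h => h ⟨n, Finset.mem_Iic.2 le_rfl⟩
  have hlast : Measurable last := measurable_pi_apply _
  have h : (traceMeasure ϑ 𝒟 S).map (Preorder.frestrictLe n) ⊗ₘ (stepKernel ϑ 𝒟).comap last hlast =
      (traceMeasure ϑ 𝒟 S).map (fun ω => (Preorder.frestrictLe n ω, ω (n + 1))) :=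
    Kernel.map_frestrictLe_trajMeasure_compProd_eq_map_trajMeasure
  have hr : Measurable (Preorder.frestrictLe (π := fun _ => Config V F P) n) := by fun_prop
  have : IsProbabilityMeasure ((traceMeasure ϑ 𝒟 S).map
      (Preorder.frestrictLe (π := fun _ => Config V F P) n)) :=
    Measure.isProbabilityMeasure_map hr.aemeasurable
  have : IsProbabilityMeasure ((traceMeasure ϑ 𝒟 S).map (fun ω => ω n)) :=
    Measure.isProbabilityMeasure_map (measurable_pi_apply n).aemeasurable
  ext s hs
  -- The identity for histories is tested on the preimage of `s` under keeping only the last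
  -- coordinate of the history.
  have hs' : MeasurableSet (Prod.map last (id : Config V F P → _) ⁻¹' s) :=
    hs.preimage (by fun_prop)
  have hκ : Measurable fun x => stepKernel ϑ 𝒟 x (Prod.mk x ⁻¹' s) :=
    Kernel.measurable_kernel_prodMk_left hs
  have h' := congrArg (fun μ => μ (Prod.map last (id : Config V F P → _) ⁻¹' s)) h
  simp only [Measure.compProd_apply hs'] at h'
  rw [Measure.map_apply (by fun_prop) hs', lintegral_map (by
    exact hκ.comp hlast) hr] at h'
  rw [Measure.compProd_apply hs, lintegral_map hκ (by fun_prop), Measure.map_apply (by fun_prop) hs]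
  exact h'.symm

theorem map_traceMeasure_zero (S : Stmt V F P) :
    (traceMeasure ϑ 𝒟 S).map (fun ω => ω 0) =
      Measure.dirac ((fun _ => 0, S, Cont.halt, 0) : Config V F P) := by
  have h0 : (fun ω : ℕ → Config V F P => ω 0) =
      (fun h : (i : Finset.Iic 0) → Config V F P => h ⟨0, Finset.mem_Iic.2 le_rfl⟩) ∘
        Preorder.frestrictLe (π := fun _ => Config V F P) 0 := rfl
  rw [h0, ← Measure.map_map (by fun_prop) (by fun_prop), traceMeasure, Kernel.trajMeasure,
    Measure.map_comp _ _ (by fun_prop), Kernel.traj_map_frestrictLe, Kernel.partialTraj_self,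
    Measure.id_comp, Measure.map_map (by fun_prop) (by fun_prop)]
  exact Measure.map_dirac' (by fun_prop) _

theorem map_traceMeasure_eval (S : Stmt V F P) (n : ℕ) :
    (traceMeasure ϑ 𝒟 S).map (fun ω => ω n) =
      (stepKernel ϑ 𝒟 ^ n) (fun _ => 0, S, Cont.halt, 0) := by
  induction n with
  | zero => rw [map_traceMeasure_zero, pow_zero]; exact (Kernel.id_apply _).symm
  | succ n ih =>
    have : stepKernel ϑ 𝒟 ^ (n + 1) = stepKernel ϑ 𝒟 ∘ₖ (stepKernel ϑ 𝒟 ^ n) := pow_succ' _ n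
    rw [this, Kernel.comp_apply, ← ih]
    rw [← Measure.snd_compProd, ← map_traceMeasure_pair, Measure.snd,
      Measure.map_map (by fun_prop) (by fun_prop)]
    rfl

/-- Terminal configurations are fixed points of the kernel, but an arbitrary sequence need not
respect this; the statement therefore holds almost surely and is read off from the law of
consecutive pairs. -/
theorem ae_isTerminal_succ (S : Stmt V F P) : ∀ᵐ ω ∂(traceMeasure ϑ 𝒟 S), ∀ n,
    (ω n).IsTerminal → (ω (n + 1)).IsTerminal ∧ (ω (n + 1)).2.2.2 = (ω n).2.2.2 := by
  refine ae_all_iff.2 fun n => ?_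
  have hmeas : MeasurableSet {q : Config V F P × Config V F P |
      q.1.IsTerminal → q.2.IsTerminal ∧ q.2.2.2.2 = q.1.2.2.2} := by
    have h₁ := Config.measurableSet_isTerminal (V := V) (F := F) (P := P)
    have h₂ : MeasurableSet {q : Config V F P × Config V F P | q.2.2.2.2 = q.1.2.2.2} :=
      measurableSet_eq_fun (by fun_prop) (by fun_prop)
    exact (h₁.preimage measurable_fst).imp ((h₁.preimage measurable_snd).inter h₂)
  have hp : Measurable fun ω : ℕ → Config V F P => (ω n, ω (n + 1)) := by fun_prop
  refine ae_of_ae_map (p := fun q : Config V F P × Config V F P =>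
    q.1.IsTerminal → q.2.IsTerminal ∧ q.2.2.2.2 = q.1.2.2.2) hp.aemeasurable ?_
  rw [map_traceMeasure_pair, Measure.ae_compProd_iff hmeas]
  refine Filter.Eventually.of_forall ?_
  rintro ⟨γ, S, K, α⟩
  by_cases h : Config.IsTerminal (γ, S, K, α)
  · obtain ⟨rfl, rfl⟩ : S = .skip ∧ K = .halt := h
    have : stepKernel ϑ 𝒟 (γ, .skip, .halt, α) = Measure.dirac (γ, .skip, .halt, α) := rfl
    rw [this, ae_dirac_eq]
    exact fun h => ⟨h, rfl⟩
  · exact Filter.Eventually.of_forall fun _ h' => absurd h' h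

theorem ae_cost_le (hM : 0 ≤ M) (h𝒟 : ∀ f, (𝒟 f).TickBdd M) {S : Stmt V F P}
    (hS : S.TickBdd M) : ∀ᵐ ω ∂(traceMeasure ϑ 𝒟 S), ∀ n : ℕ, |(ω n).2.2.2| ≤ M * n := by
  refine ae_all_iff.2 fun n => ?_
  have h := ae_pow_tickBdd (ϑ := ϑ) hM h𝒟 n
    (σ := ((fun _ => 0, S, Cont.halt, 0) : Config V F P)) hS trivial
  rw [← map_traceMeasure_eval] at h
  simpa using ae_of_ae_map (measurable_pi_apply n).aemeasurable h

theorem ae_norm_valuation_le [Fintype V] (S : Stmt V F P) {C₀ : ℝ} (hC₀ : 0 ≤ C₀)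
    (h : ∀ (n : ℕ) (x : V), ∀ᵐ ω ∂(traceMeasure ϑ 𝒟 S), |(ω (n + 1)).1 x - (ω n).1 x| ≤ C₀) :
    ∀ᵐ ω ∂(traceMeasure ϑ 𝒟 S), ∀ n : ℕ, ‖(ω n).1‖ ≤ C₀ * n := by
  have h0 : ∀ᵐ ω ∂(traceMeasure ϑ 𝒟 S), ω 0 = (fun _ => 0, S, Cont.halt, 0) := by
    refine ae_of_ae_map (f := fun ω : ℕ → Config V F P => ω 0)
      (p := fun σ => σ = (fun _ => 0, S, Cont.halt, 0)) (measurable_pi_apply 0).aemeasurable ?_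
    rw [map_traceMeasure_zero, ae_dirac_eq]
    rfl
  filter_upwards [h0, ae_all_iff.2 fun n => ae_all_iff.2 fun x => h n x] with ω h0 h n
  refine (pi_norm_le_iff_of_nonneg (by positivity)).2 fun x => ?_
  induction n with
  | zero => simp [h0]
  | succ n ih =>
    rw [Real.norm_eq_abs] at ih ⊢
    push_cast
    have := abs_add_le ((ω (n + 1)).1 x - (ω n).1 x) ((ω n).1 x)
    rw [sub_add_cancel] at this
    linarith [h n x]

end Trace

/-! ### Termination time, pointwise convergence and domination -/

section StoppingTime

variable {V F P : Type*}

theorem isTerminal_stoppingTime {ω : ℕ → Config V F P} (h : stoppingTime ω ≠ ⊤) :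
    (ω (stoppingTime ω).toNat).IsTerminal := by
  classical
  have hex : ∃ n, (ω n).IsTerminal := by
    by_contra! hn
    exact h (by simp [stoppingTime, hn])
  have : stoppingTime ω = (Nat.find hex : ℕ∞) := by
    refine le_antisymm (iInf₂_le (f := fun (n : ℕ) (_ : (ω n).IsTerminal) => (n : ℕ∞)) _
      (Nat.find_spec hex)) (le_iInf₂ fun n hn => ?_)
    exact_mod_cast Nat.find_min' hex hn
  rw [this, ENat.toNat_natCast]
  exact Nat.find_spec hex

theorem not_isTerminal_of_lt {ω : ℕ → Config V F P} {n : ℕ}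
    (h : n < (stoppingTime ω).toNat) : ¬ (ω n).IsTerminal := fun hn => by
  have h₁ : stoppingTime ω ≤ n := iInf₂_le n hn
  exact h.not_ge (ENat.toNat_le_of_le_natCast h₁)

theorem isTerminal_of_le {ω : ℕ → Config V F P} (hT : stoppingTime ω ≠ ⊤)
    (hω : ∀ n, (ω n).IsTerminal → (ω (n + 1)).IsTerminal ∧ (ω (n + 1)).2.2.2 = (ω n).2.2.2)
    {n : ℕ} (hn : (stoppingTime ω).toNat ≤ n) :
    (ω n).IsTerminal ∧ (ω n).2.2.2 = costAtTermination ω := by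
  induction n, hn using Nat.le_induction with
  | base => exact ⟨isTerminal_stoppingTime hT, rfl⟩
  | succ n _ ih => exact ⟨(hω n ih.1).1, (hω n ih.1).2.trans ih.2⟩

theorem measurable_stoppingTime [EMetricSpace P] [SecondCountableTopology P] [Countable V]
    [Countable F] : Measurable fun ω : ℕ → Config V F P => (stoppingTime ω : ℝ≥0∞) := by
  classical
  have h : (fun ω : ℕ → Config V F P => (stoppingTime ω : ℝ≥0∞)) =
      fun ω => ⨅ n : ℕ, if (ω n).IsTerminal then (n : ℝ≥0∞) else ⊤ := by
    ext ω
    simp only [stoppingTime, ENat.toENNReal_iInf]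
    refine iInf_congr fun n => ?_
    split_ifs with h <;> simp [h]
  rw [h]
  exact .iInf fun n => Measurable.ite
    (Config.measurableSet_isTerminal.preimage (measurable_pi_apply n))
    measurable_const measurable_const

/-- From time `T` on, the trace is terminal and its cost frozen, so the payoff is eventually
constant. The deduction, and with it the horizon-dependent allowance `A n`, no longer occurs. -/
theorem tendsto_payoff [Fintype V] {d : ℕ} {C : ℝ} {A : ℕ → ℝ} {ω : ℕ → Config V F P}
    (hT : stoppingTime ω ≠ ⊤)
    (hω : ∀ n, (ω n).IsTerminal → (ω (n + 1)).IsTerminal ∧ (ω (n + 1)).2.2.2 = (ω n).2.2.2) :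
    Filter.Tendsto (fun n => payoff d C (A n) (ω n)) Filter.atTop
      (nhds (costAtTermination ω)) := by
  refine tendsto_const_nhds.congr' ?_
  filter_upwards [Filter.eventually_ge_atTop (stoppingTime ω).toNat] with n hn
  obtain ⟨h₁, h₂⟩ := isTerminal_of_le hT hω hn
  rw [payoff, if_pos h₁, h₂]

/-- Up to time `T` every quantity in the payoff is controlled by a power of `T` of exponent at most
`d`; after `T` only the frozen cost remains. The bound does not depend on `n`, although the
allowance `2 * C * n` does, because that allowance is charged only while `n < T`. -/
theorem abs_payoff_le [Fintype V] {d : ℕ} (hd : 1 ≤ d) {C C₀ M : ℝ} (hC : 0 ≤ C) (hC₀ : 0 ≤ C₀)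
    (hM : 0 ≤ M) {ω : ℕ → Config V F P} (hT : stoppingTime ω ≠ ⊤)
    (hω : ∀ n, (ω n).IsTerminal → (ω (n + 1)).IsTerminal ∧ (ω (n + 1)).2.2.2 = (ω n).2.2.2)
    (hα : ∀ n : ℕ, |(ω n).2.2.2| ≤ M * n) (hγ : ∀ n : ℕ, ‖(ω n).1‖ ≤ C₀ * n) (n : ℕ) :
    |payoff d C (2 * C * n) (ω n)| ≤
      C * (1 + C₀) ^ d + (M + C * (1 + C₀) ^ d + 2 * C) * ((stoppingTime ω).toNat : ℝ) ^ d := by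
  set t := (stoppingTime ω).toNat
  have htd : (t : ℝ) ≤ (t : ℝ) ^ d := by exact_mod_cast Nat.le_self_pow (by omega) t
  have hMt : M * t ≤ M * (t : ℝ) ^ d := mul_le_mul_of_nonneg_left htd hM
  have h0 : 0 ≤ C * (1 + C₀) ^ d := by positivity
  have h1 : 0 ≤ C * (1 + C₀) ^ d * (t : ℝ) ^ d := by positivity
  have h2 : 2 * C * t ≤ 2 * C * (t : ℝ) ^ d := mul_le_mul_of_nonneg_left htd (by positivity)
  have h3 : 0 ≤ 2 * C * (t : ℝ) := by positivity
  rcases le_or_gt t n with hn | hn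
  · obtain ⟨h₁, h₂⟩ := isTerminal_of_le hT hω hn
    rw [payoff, if_pos h₁, h₂]
    have : |costAtTermination ω| ≤ M * t := hα t
    linarith
  · rw [payoff, if_neg (not_isTerminal_of_lt hn)]
    have hnt : (n : ℝ) ≤ t := by exact_mod_cast hn.le
    have ht1 : (1 : ℝ) ≤ t := by exact_mod_cast (Nat.zero_le n).trans_lt hn
    -- A trace not yet terminated at time `n` has `T ≥ 1`, which absorbs the summand `1`.
    have hbase : 1 + ‖(ω n).1‖ ≤ (1 + C₀) * t := by
      have := (hγ n).trans (mul_le_mul_of_nonneg_left hnt hC₀)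
      linarith
    have hpow : C * (1 + ‖(ω n).1‖) ^ d ≤ C * (1 + C₀) ^ d * (t : ℝ) ^ d := by
      rw [mul_assoc, ← mul_pow]
      gcongr
    have hpos : 0 ≤ C * (1 + ‖(ω n).1‖) ^ d + 2 * C * n := by positivity
    have hαn := (hα n).trans (mul_le_mul_of_nonneg_left hnt hM)
    have hCn : 2 * C * (n : ℝ) ≤ 2 * C * t := mul_le_mul_of_nonneg_left hnt (by positivity)
    have := abs_sub (ω n).2.2.2 (C * (1 + ‖(ω n).1‖) ^ d + 2 * C * n)
    rw [abs_of_nonneg hpos] at this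
    linarith

end StoppingTime

end Appl

/-! ### Passage to the limit by dominated convergence -/

open Appl in
theorem mainTheorem1 {V F P : Type*} [Finite V] [DecidableEq V] [Finite F]
    [EMetricSpace P] [SecondCountableTopology P] [MeasurableSpace P] [BorelSpace P]
    (ϑ : Kernel P ℝ) [IsMarkovKernel ϑ]
    (𝒟 : F → Appl.Stmt V F P) (S_main : Appl.Stmt V F P)
    (Δ : F → List (Appl.Spec V)) (d : ℕ) (hd : 1 ≤ d)
    (Γ Γ' : Appl.LogCtx V) (Q : Appl.Pot V)
    (hΔ : Appl.ValidCtx ϑ (Appl.IsPolynomialPot d) 𝒟 Δ)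
    (hmain : Appl.Triple ϑ (Appl.IsPolynomialPot d) Δ Γ Q S_main Γ' (fun _ => 0))
    (hinit : Γ (fun _ => 0))
    (hT : ∫⁻ ω, (Appl.stoppingTime ω : ℝ≥0∞) ^ d ∂(Appl.traceMeasure ϑ 𝒟 S_main) < ∞)
    (hbdd : ∃ C₀ : ℝ, 0 ≤ C₀ ∧ ∀ (n : ℕ) (x : V), ∀ᵐ ω ∂(Appl.traceMeasure ϑ 𝒟 S_main),
      |(ω (n + 1)).1 x - (ω n).1 x| ≤ C₀) :
    (∀ᵐ ω ∂(Appl.traceMeasure ϑ 𝒟 S_main), Appl.stoppingTime ω ≠ ⊤) ∧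
    Integrable Appl.costAtTermination (Appl.traceMeasure ϑ 𝒟 S_main) ∧
    ∫ ω, Appl.costAtTermination ω ∂(Appl.traceMeasure ϑ 𝒟 S_main) ≤ Q (fun _ => 0) := by
  have := Fintype.ofFinite V
  obtain ⟨C₀, hC₀, hγ⟩ := hbdd
  -- A common `C` for the derivations of all function bodies and of the main statement: there are
  -- finitely many functions, each with a finite list of specifications.
  obtain ⟨C, hC, hΔC, hmainC⟩ := ((Filter.eventually_ge_atTop 0).and
    ((hΔ.eventually fun Q hQ => hQ.eventually_polyBdd).and
      (hmain.eventually fun Q hQ => hQ.eventually_polyBdd))).exists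
  obtain ⟨M, hM, h𝒟M, hSM⟩ := ((Filter.eventually_ge_atTop 0).and
    ((Filter.eventually_all.2 fun f => (𝒟 f).eventually_tickBdd).and
      S_main.eventually_tickBdd)).exists
  have hTm : Measurable fun ω : ℕ → Config V F P => (stoppingTime ω : ℝ≥0∞) ^ d :=
    measurable_stoppingTime.pow_const d
  have hfin : ∀ᵐ ω ∂(traceMeasure ϑ 𝒟 S_main), stoppingTime ω ≠ ⊤ := by
    -- A finite moment of order `d ≥ 1` excludes `T = ∞` with positive probability; for `d = 0` it
    -- would not.
    filter_upwards [ae_lt_top hTm hT.ne] with ω hω htop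
    simp [htop, ENNReal.top_pow (by omega : d ≠ 0)] at hω
  have hTi : Integrable (fun ω => ((stoppingTime ω).toNat : ℝ) ^ d)
      (traceMeasure ϑ 𝒟 S_main) := by
    refine (integrable_toReal_of_lintegral_ne_top hTm.aemeasurable hT.ne).congr ?_
    filter_upwards [hfin] with ω hω
    obtain ⟨t, ht⟩ := ENat.ne_top_iff_exists.1 hω
    simp [← ht]
  set B : (ℕ → Config V F P) → ℝ := fun ω =>
    C * (1 + C₀) ^ d + (M + C * (1 + C₀) ^ d + 2 * C) * ((stoppingTime ω).toNat : ℝ) ^ d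
  have hBi : Integrable B (traceMeasure ϑ 𝒟 S_main) := (integrable_const _).add (hTi.const_mul _)
  have hgm (n : ℕ) : Measurable fun ω : ℕ → Config V F P => payoff d C (2 * C * n) (ω n) :=
    measurable_payoff.comp (measurable_pi_apply n)
  have hgB : ∀ᵐ ω ∂(traceMeasure ϑ 𝒟 S_main), ∀ n : ℕ, ‖payoff d C (2 * C * n) (ω n)‖ ≤ B ω := by
    filter_upwards [hfin, ae_isTerminal_succ S_main, ae_cost_le hM h𝒟M hSM,
      ae_norm_valuation_le S_main hC₀ hγ] with ω h₁ h₂ h₃ h₄ n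
      using abs_payoff_le hd hC hC₀ hM h₁ h₂ h₃ h₄ n
  have hlim : ∀ᵐ ω ∂(traceMeasure ϑ 𝒟 S_main), Filter.Tendsto
      (fun n : ℕ => payoff d C (2 * C * n) (ω n)) Filter.atTop (nhds (costAtTermination ω)) := by
    filter_upwards [hfin, ae_isTerminal_succ S_main] with ω h₁ h₂ using tendsto_payoff h₁ h₂
  have hle (n : ℕ) : ∫ ω, payoff d C (2 * C * n) (ω n) ∂(traceMeasure ϑ 𝒟 S_main) ≤
      Q (fun _ => 0) := by
    have hi : Integrable (fun ω => payoff d C (2 * C * n) (ω n)) (traceMeasure ϑ 𝒟 S_main) :=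
      hBi.mono' (hgm n).aestronglyMeasurable (hgB.mono fun ω h => h n)
    have hn := (measurable_pi_apply (X := fun _ => Config V F P) n).aemeasurable
      (μ := traceMeasure ϑ 𝒟 S_main)
    have hg := (measurable_payoff (V := V) (F := F) (P := P) (d := d) (C := C)
      (A := 2 * C * n)).aestronglyMeasurable (μ := (traceMeasure ϑ 𝒟 S_main).map fun ω => ω n)
    -- There is no frame at the start, so the whole allowance `2 * C * n` is available for the calls
    -- made within the horizon. The postcondition potential `0` matches the empty continuation,
    -- which pays out exactly the cost.
    have key := Triple.expBound (A := 2 * C * n) hΔC hC n hmainC .halt 0 (by simp)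
      (fun m _ γ α _ => (expBound_halt m γ α).mono (by simp)) (fun _ => 0) 0 hinit
    rw [ExpBound, ← map_traceMeasure_eval, integral_map hn hg, integrable_map_measure hg hn] at key
    -- Domination by `B` supplies the integrability on which the bound was conditional.
    simpa using key hi
  refine ⟨hfin, ?_, ?_⟩
  · refine hBi.mono' (aestronglyMeasurable_of_tendsto_ae Filter.atTop
      (fun n => (hgm n).aestronglyMeasurable) hlim) ?_
    filter_upwards [hlim, hgB] with ω h₁ h₂
    exact le_of_tendsto h₁.norm (Filter.Eventually.of_forall h₂)
  · exact le_of_tendsto (tendsto_integral_of_dominated_convergence B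
      (fun n => (hgm n).aestronglyMeasurable) hBi (fun n => hgB.mono fun ω h => h n) hlim)
      (Filter.Eventually.of_forall hle)
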